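/- **Modules.** Fix a set of variables with values in a common domain $D$. A (labelled reactive) module $M=(X,I,L,T,\lambda,\iota)$ consists of disjoint finite sets $X$ (internal variables) and $I$ (external variables), a set $L$ of states with initial state $\iota$, valuations $\lambda(q)\in D^X$ of the states $q$, and labelled transitions $p\xrightarrow{v,a}q$ with $p,q\in L$, $v\in D^I$ and a label $a$ (a set of label names, in general a singleton). A module is an *agent* if for all $p\in L$, $v\in D^I$ there is at least one transition from $p$ under $v$, and if any two transitions $p\xrightarrow{v,a}q$, $p'\xrightarrow{v',a}q'$ with the same label satisfy $\lambda(p)=\lambda(p')$, $\lambda(q)=\lambda(q')$, and there are transitions (with some labels) from $p$ to $q$ under $v'$ and from $p'$ to $q'$ under $v$. *Synchronization on data.* For valuations, $\sim$ means agreement on common variables. $M_1|M_2$ has internal variables $X_1\cup X_2$, external variables $(I_1\cup I_2)\setminus(X_1\cup X_2)$, states $L_1\times L_2$, $\lambda(q_1,q_2)=\lambda_1(q_1)\cup\lambda_2(q_2)$, initial state $(\iota_1,\iota_2)$; whenever $q_1\xrightarrow{\alpha_1,a_1}q_1'$, $q_2\xrightarrow{\alpha_2,a_2}q_2'$, $\alpha_1\sim\alpha_2$,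 $\lambda_1(q_1)\sim\alpha_2$, $\lambda_2(q_2)\sim\alpha_1$, it has, under the restriction of $\alpha_1\cup\alpha_2$ to the external variables, the transitions $(q_1,q_2)\to(q_1',q_2)$ labelled $a_1$ and $(q_1,q_2)\to(q_1,q_2')$ labelled $a_2$. *Closure.* The closure of $M$ with $v_{init}\in D^I$ has the states $L\times D^I$, initial state $(\iota,v_{init})$, and the transitions $(p,v)\xrightarrow{a}(q,v)$ for $p\xrightarrow{v,a}q$ and $(p,v)\xrightarrow{\emptyset}(p,w)$ for $v,w$ differing in exactly one variable. **Nets.** A labelled net with read arcs has places, transitions $t$ with sets ${}^\bullet t,t^\bullet,{}^\otimes t$ of preconditions, postconditions and activators, an initial marking, and labels $\ell(t)$ that are sets of label names. $t$ is enabled at $m$ if $m(p)\ge1$ on ${}^\bullet t\cup{}^\otimes t$; firing removes a token from ${}^\bullet t\setminus t^\bullet$ and adds one to $t^\bullet\setminus{}^\bullet t$. The marking graph has the reachable markings as states and arcs $m\xrightarrow{\ell(t)}m'$ for firings. The net is 1-safe if $m(p)\le1$ for all reachable $m$. **Agent nets.** Let $A$ be the transition system of $M$ with arcs $(p,a,q)$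 such that $p\xrightarrow{v,a}q$ for some $v$. Choose a partition of the arcs into classes of equally labelled arcs, the classes being the net transitions, and a set $R$ of regions (sets of states which each class uniformly enters, leaves, or does not cross) with: any two distinct states are separated by some $r\in R$; and if no arc of the class $t$ starts in $s$, there is $r\in R$ with $s\notin r$ which $t$ leaves or is inside of. The places are: $r\in R$, a precondition (postcondition) of $t$ if $t$ leaves (enters) $r$ or is inside $r$, initially marked iff $\iota\in r$; and, for $x\in X$, $d\in D$, a new place $x_d$, a precondition (postcondition) of $t$ iff $t$ leaves (enters) $\{q:\lambda(q)(x)=d\}$, marked iff $\lambda(\iota)(x)=d$. For the external variables, choose $init\in D^I$ and add places $y_d$ ($y\in I$, $d\in D$), marked iff $init(y)=d$, and transitions with empty label from $y_j$ to $y_k$ for $j\ne k$. Let $V_t$ be the set of $v\in D^I$ such that $p\xrightarrow{v,a}q$ for some arc $(p,a,q)$ of $t$, and $I_t$ the set of external variables a change of whose value can lead from $V_t$ out of $V_t$. Replace $t$ by copies $t_{val}$, for $val\in\{v|_{I_t}:v\in V_t\}$, with the same label, preconditions and postconditions, and with activators $y_{val(y)}$, $y\in I_t$. The result is $\Sigma_{int}$.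 **Fusion.** Fusing two such nets identifies each external component $\{y_d:d\in D\}$ of one net with the component $\{x_d:d\in D\}$ of the internal variable $x=y$ of the other net, if there is one: the places of the external component are removed, and arcs and read arcs at $y_d$ are moved to $x_d$. A transition $t$ moving the token of an identified internal component from $p$ to $q$ is glued to the set of all transitions of the other net that make the corresponding move in an external component identified with such a component (one transition of the fusion for each pair $(p,q)$); transitions that touch no identified component are kept; all others disappear. Labels are united. **Proposition.** Let $M_1,\dots,M_n$ ($n\ge1$) be agents with pairwise disjoint sets $X_i$ of internal variables such that $I_i\subseteq\bigcup_jX_j$ for all $i$. Let $\Sigma_{1,int},\dots,\Sigma_{n,int}$ be agent nets obtained as above, for any choice of the partitions and regions, with $init_i(x)=\lambda_j(\iota_j)(x)$ for $x\in I_i\cap X_j$. Let $\Sigma$ be obtained by successive fusion of $\Sigma_{1,int},\dots,\Sigma_{n,int}$, and let $G$ be the closure of $(\cdots(M_1|M_2)|\cdots)|M_n$. Then $\Sigma$ is 1-safe, and the marking graph of $\Sigma$ is isomorphic to the reachable part of $G$ as a graph with an initial state. It is isomorphic to it as a labelled transition system with an initial state if, in every agent net, the valuations under which a net transition can occur are the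 same for all its arcs, that is, $p\xrightarrow{v,a}q\iff p'\xrightarrow{v,a}q'$ for all $v$ and all arcs $(p,a,q),(p',a,q')$ of one class. -/

import Mathlib

universe u

namespace MAS

/-! ### Labelled transition systems -/

/-- Initialised labelled transition systems. -/
structure LTS (Lab : Type u) where
  State : Type u
  Tr : State → Lab → State → Prop
  init : State

namespace LTS

variable {Lab : Type u}

/-- `s'` is a successor of `s` along some arc. -/
def Step (A : LTS Lab) (s s' : A.State) : Prop := ∃ a, A.Tr s a s'

def Reachable (A : LTS Lab) (s : A.State) : Prop := Relation.ReflTransGen A.Step A.init s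

/-- The part of `A` that is reachable from its initial state. -/
def reachablePart (A : LTS Lab) : LTS Lab where
  State := {s : A.State // A.Reachable s}
  Tr s a s' := A.Tr s.1 a s'.1
  init := ⟨A.init, Relation.ReflTransGen.refl⟩

/-- Isomorphism of the underlying rooted directed graphs (labels are forgotten). -/
structure GraphIso (A B : LTS Lab) where
  toEquiv : A.State ≃ B.State
  map_init : toEquiv A.init = B.init
  map_step : ∀ s s', A.Step s s' ↔ B.Step (toEquiv s) (toEquiv s')

/-- Isomorphism of labelled transition systems. -/
structure Iso (A B : LTS Lab) where
  toEquiv : A.State ≃ B.State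
  map_init : toEquiv A.init = B.init
  map_tr : ∀ s a s', A.Tr s a s' ↔ B.Tr (toEquiv s) a (toEquiv s')

/-- The arcs of a labelled transition system. -/
structure Arc (A : LTS Lab) where
  src : A.State
  lab : Lab
  tgt : A.State
  tr : A.Tr src lab tgt

end LTS

/-! ### Labelled net systems with read arcs -/

/-- A labelled net system with read arcs. The flow relation is given by presets and postsets of
transitions; every transition is labelled with a set of labels. -/
structure Net (Lbl : Type u) where
  Place : Type u
  Trans : Type u
  pre : Trans → Set Place
  post : Trans → Set Place
  read : Trans → Set Place
  init : Place → ℕ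
  label : Trans → Set Lbl

namespace Net

variable {Lbl : Type u}

/-- All preconditions and all activators of `t` carry a token. -/
def Enabled (N : Net Lbl) (m : N.Place → ℕ) (t : N.Trans) : Prop :=
  ∀ p ∈ N.pre t ∪ N.read t, 1 ≤ m p

open Classical in
/-- The marking produced from `m` by the occurrence of `t`. -/
noncomputable def fire (N : Net Lbl) (m : N.Place → ℕ) (t : N.Trans) : N.Place → ℕ := fun p =>
  if p ∈ N.pre t \ N.post t then m p - 1
  else if p ∈ N.post t \ N.pre t then m p + 1
  else m p

/-- The transition system of all markings. -/
def markingLTS (N : Net Lbl) : LTS (Set Lbl) where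
  State := N.Place → ℕ
  Tr m a m' := ∃ t, N.label t = a ∧ N.Enabled m t ∧ m' = N.fire m t
  init := N.init

/-- The marking graph: the reachable markings, with arcs labelled by the labels of transitions. -/
def markingGraph (N : Net Lbl) : LTS (Set Lbl) := N.markingLTS.reachablePart

def OneSafe (N : Net Lbl) : Prop := ∀ m, N.markingLTS.Reachable m → ∀ p, m p ≤ 1

end Net

/-! ### Fusion of sequential components -/

/-- Families of sets of places of two nets to be identified, with the identifying bijections.
The places of the components `X₂ i` are going to be replaced by those of `X₁ i`, and the places of
the components `X₁' i` by those of `X₂' i`. -/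
structure FusionData {Lbl : Type u} (N₁ N₂ : Net Lbl) where
  Idx : Type u
  X₁ : Idx → Set N₁.Place
  X₂ : Idx → Set N₂.Place
  ρ : ∀ i, X₁ i ≃ X₂ i
  Idx' : Type u
  X₁' : Idx' → Set N₁.Place
  X₂' : Idx' → Set N₂.Place
  ρ' : ∀ i, X₂' i ≃ X₁' i

namespace FusionData

variable {Lbl : Type u} {N₁ N₂ : Net Lbl}

/-- The places that survive the fusion:
all of `P₁ ⊎ P₂` except `⋃ X₂ \ ⋃ X₂'` and `⋃ X₁' \ ⋃ X₁`. -/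
def Kept (F : FusionData N₁ N₂) : N₁.Place ⊕ N₂.Place → Prop
  | Sum.inl p => ¬ (p ∈ (⋃ i, F.X₁' i) \ ⋃ i, F.X₁ i)
  | Sum.inr p => ¬ (p ∈ (⋃ i, F.X₂ i) \ ⋃ i, F.X₂' i)

abbrev FPlace (F : FusionData N₁ N₂) : Type u := {p : N₁.Place ⊕ N₂.Place // F.Kept p}

/-- `p` is the name, after the fusion, of the place `p'` of one of the two nets: `p'` itself if it
survives, and otherwise the place identified with `p'`. -/
def Names (F : FusionData N₁ N₂) (p : F.FPlace) (p' : N₁.Place ⊕ N₂.Place) : Prop :=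
  p.1 = p' ∨
  (¬ F.Kept p' ∧
    ((∃ i, ∃ a : F.X₁ i, p.1 = Sum.inl a.1 ∧ p' = Sum.inr (F.ρ i a).1) ∨
     (∃ i, ∃ b : F.X₂' i, p.1 = Sum.inr b.1 ∧ p' = Sum.inl (F.ρ' i b).1)))

/-- The transitions of `N₂` to be glued to the transition `t₁` of `N₁`, which moves the token of
some components `X₁ i` from `p` to `q`. -/
def glueR (F : FusionData N₁ N₂) (t₁ : N₁.Trans) (p q : N₁.Place) : Set N₂.Trans :=
  {t₂ | ∃ i, ∃ (hp : p ∈ F.X₁ i) (hq : q ∈ F.X₁ i),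
    F.X₁ i ∩ N₁.pre t₁ = {p} ∧ F.X₁ i ∩ N₁.post t₁ = {q} ∧
    (F.ρ i ⟨p, hp⟩).1 ∈ N₂.pre t₂ ∧ (F.ρ i ⟨q, hq⟩).1 ∈ N₂.post t₂}

/-- The transitions of `N₁` to be glued to the transition `t₂` of `N₂`, which moves the token of
some components `X₂' i` from `p` to `q`. -/
def glueL (F : FusionData N₁ N₂) (t₂ : N₂.Trans) (p q : N₂.Place) : Set N₁.Trans :=
  {t₁ | ∃ i, ∃ (hp : p ∈ F.X₂' i) (hq : q ∈ F.X₂' i),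
    F.X₂' i ∩ N₂.pre t₂ = {p} ∧ F.X₂' i ∩ N₂.post t₂ = {q} ∧
    (F.ρ' i ⟨p, hp⟩).1 ∈ N₁.pre t₁ ∧ (F.ρ' i ⟨q, hq⟩).1 ∈ N₁.post t₁}

/-- The pairs of sets of transitions that are the transitions of the fusion: glued ones, and those
that stay alone because they do not move tokens of the components. -/
def IsTrans (F : FusionData N₁ N₂) (U : Set N₁.Trans × Set N₂.Trans) : Prop :=
  (∃ t₁ p q, U = ({t₁}, F.glueR t₁ p q) ∧ (F.glueR t₁ p q).Nonempty) ∨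
  (∃ t₂ p q, U = (F.glueL t₂ p q, {t₂}) ∧ (F.glueL t₂ p q).Nonempty) ∨
  (∃ t, U = ({t}, ∅) ∧
    (N₁.pre t ∩ ((⋃ i, F.X₁ i) ∪ ⋃ i, F.X₁' i) = ∅ ∨
     N₁.post t ∩ ((⋃ i, F.X₁ i) ∪ ⋃ i, F.X₁' i) = ∅)) ∨
  (∃ t, U = (∅, {t}) ∧
    (N₂.pre t ∩ ((⋃ i, F.X₂ i) ∪ ⋃ i, F.X₂' i) = ∅ ∨
     N₂.post t ∩ ((⋃ i, F.X₂ i) ∪ ⋃ i, F.X₂' i) = ∅))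

abbrev FTrans (F : FusionData N₁ N₂) : Type u :=
  {U : Set N₁.Trans × Set N₂.Trans // F.IsTrans U}

/-- The places of the fusion naming some place attached (by `f₁`, `f₂`) to a member of `U`. -/
def attached (F : FusionData N₁ N₂) (f₁ : N₁.Trans → Set N₁.Place) (f₂ : N₂.Trans → Set N₂.Place)
    (U : F.FTrans) : Set F.FPlace :=
  {p | (∃ t₁ ∈ U.1.1, ∃ p' ∈ f₁ t₁, F.Names p (Sum.inl p')) ∨
       (∃ t₂ ∈ U.1.2, ∃ p' ∈ f₂ t₂, F.Names p (Sum.inr p'))}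

/-- The fusion of two nets. -/
def fusion (F : FusionData N₁ N₂) : Net Lbl where
  Place := F.FPlace
  Trans := F.FTrans
  pre := F.attached N₁.pre N₂.pre
  post := F.attached N₁.post N₂.post
  read := F.attached N₁.read N₂.read
  init p := Sum.elim N₁.init N₂.init p.1
  label U := (⋃ t ∈ U.1.1, N₁.label t) ∪ ⋃ t ∈ U.1.2, N₂.label t

end FusionData

/-- A net with distinguished pairwise disjoint components: one for each internal variable, and
external ones (possibly several for the same variable). The places of a component `c` are
`port c d`, where `d` runs through the domain of values. -/
structure INet (Var D Lbl : Type u) extends Net Lbl where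
  IntComp : Type u
  intVar : IntComp → Var
  ExtComp : Type u
  extVar : ExtComp → Var
  port : IntComp ⊕ ExtComp → D → Place
  port_inj : ∀ {c c' d d'}, port c d = port c' d' → c = c' ∧ d = d'

namespace INet

variable {Var D Lbl : Type u}

theorem port_injective (N : INet Var D Lbl) (c : N.IntComp ⊕ N.ExtComp) :
    Function.Injective (N.port c) := fun _ _ h => (N.port_inj h).2

/-- The places of a component. -/
def comp (N : INet Var D Lbl) (c : N.IntComp ⊕ N.ExtComp) : Set N.Place := Set.range (N.port c)

/-- The bijection between two components that preserves values. -/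
noncomputable def compEquiv (N N' : INet Var D Lbl) (c : N.IntComp ⊕ N.ExtComp) (c' : N'.IntComp ⊕ N'.ExtComp) :
    N.comp c ≃ N'.comp c' :=
  (Equiv.ofInjective _ (N.port_injective c)).symm.trans
    (Equiv.ofInjective _ (N'.port_injective c'))

/-- Every external component of one net is identified with the internal component, for the same
variable, of the other net (if there is one). -/
noncomputable def fusionData (N₁ N₂ : INet Var D Lbl) : FusionData N₁.toNet N₂.toNet where
  Idx := {c : N₁.IntComp × N₂.ExtComp // N₁.intVar c.1 = N₂.extVar c.2}
  X₁ i := N₁.comp (Sum.inl i.1.1)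
  X₂ i := N₂.comp (Sum.inr i.1.2)
  ρ i := compEquiv N₁ N₂ (Sum.inl i.1.1) (Sum.inr i.1.2)
  Idx' := {c : N₂.IntComp × N₁.ExtComp // N₂.intVar c.1 = N₁.extVar c.2}
  X₁' i := N₁.comp (Sum.inr i.1.2)
  X₂' i := N₂.comp (Sum.inl i.1.1)
  ρ' i := compEquiv N₂ N₁ (Sum.inl i.1.1) (Sum.inr i.1.2)

/-- Components of the fusion: all the internal ones, and the external ones not identified. -/
abbrev FInt (N₁ N₂ : INet Var D Lbl) : Type u := N₁.IntComp ⊕ N₂.IntComp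

abbrev FExt (N₁ N₂ : INet Var D Lbl) : Type u :=
  {e : N₁.ExtComp // ∀ b, N₂.intVar b ≠ N₁.extVar e} ⊕ {e : N₂.ExtComp // ∀ a, N₁.intVar a ≠ N₂.extVar e}

def rawPort (N₁ N₂ : INet Var D Lbl) : FInt N₁ N₂ ⊕ FExt N₁ N₂ → D → N₁.Place ⊕ N₂.Place
  | Sum.inl (Sum.inl a), d => Sum.inl (N₁.port (Sum.inl a) d)
  | Sum.inl (Sum.inr b), d => Sum.inr (N₂.port (Sum.inl b) d)
  | Sum.inr (Sum.inl e), d => Sum.inl (N₁.port (Sum.inr e.1) d)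
  | Sum.inr (Sum.inr e), d => Sum.inr (N₂.port (Sum.inr e.1) d)

theorem rawPort_kept (N₁ N₂ : INet Var D Lbl) (c : FInt N₁ N₂ ⊕ FExt N₁ N₂) (d : D) :
    (fusionData N₁ N₂).Kept (rawPort N₁ N₂ c d) := by
  rcases c with (a | b) | (e | e)
  · rintro ⟨h, -⟩
    obtain ⟨i, d', h⟩ := Set.mem_iUnion.1 h
    cases (N₁.port_inj h).1
  · rintro ⟨h, -⟩
    obtain ⟨i, d', h⟩ := Set.mem_iUnion.1 h
    cases (N₂.port_inj h).1
  · rintro ⟨h, -⟩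
    obtain ⟨i, d', h⟩ := Set.mem_iUnion.1 h
    have h1 := Sum.inr.inj (N₁.port_inj h).1
    exact e.2 i.1.1 (i.2.trans (congrArg N₁.extVar h1))
  · rintro ⟨h, -⟩
    obtain ⟨i, d', h⟩ := Set.mem_iUnion.1 h
    have h1 := Sum.inr.inj (N₂.port_inj h).1
    exact e.2 i.1.1 (i.2.trans (congrArg N₂.extVar h1))

theorem rawPort_inj (N₁ N₂ : INet Var D Lbl) {c c' : FInt N₁ N₂ ⊕ FExt N₁ N₂} {d d' : D}
    (h : rawPort N₁ N₂ c d = rawPort N₁ N₂ c' d') : c = c' ∧ d = d' := by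
  rcases c with (a | b) | (⟨e, he⟩ | ⟨e, he⟩) <;>
    rcases c' with (a' | b') | (⟨e', he'⟩ | ⟨e', he'⟩) <;>
    simp only [rawPort, Sum.inl.injEq, Sum.inr.injEq, reduceCtorEq] at h <;>
    first
    | (have := N₁.port_inj h; simp_all)
    | (have := N₂.port_inj h; simp_all)

/-- Composition of two nets by fusion of sequential components. -/
noncomputable def fuse (N₁ N₂ : INet Var D Lbl) : INet Var D Lbl where
  toNet := (fusionData N₁ N₂).fusion
  IntComp := FInt N₁ N₂
  intVar := Sum.elim N₁.intVar N₂.intVar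
  ExtComp := FExt N₁ N₂
  extVar := Sum.elim (fun e => N₁.extVar e.1) (fun e => N₂.extVar e.1)
  port c d := ⟨rawPort N₁ N₂ c d, rawPort_kept N₁ N₂ c d⟩
  port_inj h := rawPort_inj N₁ N₂ (congrArg Subtype.val h)

end INet

/-! ### Reactive modules -/

/-- Two valuations are compatible: they agree on the common variables. -/
def Compat {Var D : Type u} {Y Z : Set Var} (v : Y → D) (w : Z → D) : Prop :=
  ∀ x (hy : x ∈ Y) (hz : x ∈ Z), v ⟨x, hy⟩ = w ⟨x, hz⟩

/-- Labelled reactive modules. `Tr p v a q` says that under the valuation `v` of the external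
variables there is a transition from `p` to `q` with label `a` (a set of labels, usually a
singleton). -/
structure ReactiveModule (Var D Lbl : Type u) where
  X : Set Var
  I : Set Var
  X_finite : X.Finite
  I_finite : I.Finite
  disj : Disjoint X I
  State : Type u
  val : State → X → D
  Tr : State → (I → D) → Set Lbl → State → Prop
  init : State

namespace ReactiveModule

variable {Var D Lbl : Type u}

/-- The underlying transition system, where valuations of external variables are forgotten. -/
def toLTS (M : ReactiveModule Var D Lbl) : LTS (Set Lbl) where
  State := M.State
  Tr p a q := ∃ v, M.Tr p v a q
  init := M.init

/-- The requirements on the modules of single agents: in every state there is a transition for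
every valuation of the external variables, and transitions with equal labels start in states with
equal valuations, end in states with equal valuations, and are possible under each other's
valuation of the external variables. -/
structure IsAgent (M : ReactiveModule Var D Lbl) : Prop where
  total : ∀ p v, ∃ a q, M.Tr p v a q
  label : ∀ {p v a q p' v' q'}, M.Tr p v a q → M.Tr p' v' a q' →
    M.val p = M.val p' ∧ M.val q = M.val q' ∧ (∃ b, M.Tr p v' b q) ∧ ∃ b, M.Tr p' v b q'

open Classical in
/-- Universal closure: the external variables become internal and may be changed freely, one at
a time, by transitions with empty label. -/
noncomputable def closure (M : ReactiveModule Var D Lbl) (vinit : M.I → D) :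
    ReactiveModule Var D Lbl where
  X := M.X ∪ M.I
  I := ∅
  X_finite := M.X_finite.union M.I_finite
  I_finite := Set.finite_empty
  disj := disjoint_bot_right
  State := M.State × (M.I → D)
  val s x := if h : x.1 ∈ M.X then M.val s.1 ⟨x.1, h⟩ else s.2 ⟨x.1, x.2.resolve_left h⟩
  Tr s _ a s' :=
    (M.Tr s.1 s.2 a s'.1 ∧ s'.2 = s.2) ∨
    (s'.1 = s.1 ∧ a = ∅ ∧ ∃ i, s.2 i ≠ s'.2 i ∧ ∀ j, j ≠ i → s.2 j = s'.2 j)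
  init := (M.init, vinit)

open Classical in
/-- Composition with synchronization on data. -/
noncomputable def par (M₁ M₂ : ReactiveModule Var D Lbl) : ReactiveModule Var D Lbl where
  X := M₁.X ∪ M₂.X
  I := (M₁.I ∪ M₂.I) \ (M₁.X ∪ M₂.X)
  X_finite := M₁.X_finite.union M₂.X_finite
  I_finite := (M₁.I_finite.union M₂.I_finite).subset Set.sdiff_subset
  disj := Set.disjoint_sdiff_right
  State := M₁.State × M₂.State
  val s x := if h : x.1 ∈ M₁.X then M₁.val s.1 ⟨x.1, h⟩ else M₂.val s.2 ⟨x.1, x.2.resolve_left h⟩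
  Tr s α a s' := ∃ α₁ α₂ a₁ a₂ q₁ q₂,
    M₁.Tr s.1 α₁ a₁ q₁ ∧ M₂.Tr s.2 α₂ a₂ q₂ ∧
    Compat α₁ α₂ ∧ Compat (M₁.val s.1) α₂ ∧ Compat (M₂.val s.2) α₁ ∧
    Compat α α₁ ∧ Compat α α₂ ∧
    ((a = a₁ ∧ s' = (q₁, s.2)) ∨ (a = a₂ ∧ s' = (s.1, q₂)))
  init := (M₁.init, M₂.init)

end ReactiveModule

/-! ### Synthesis of nets by regions -/

/-- A splitting of the arcs of `A` into net transitions (arcs of one transition have the same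
label), and a set of regions that solves all separation problems. -/
structure Synthesis {Lab : Type u} (A : LTS Lab) where
  T : Type u
  cls : A.Arc → T
  cls_surjective : Function.Surjective cls
  lab : T → Lab
  lab_cls : ∀ a, lab (cls a) = a.lab
  R : Set (Set A.State)
  region : ∀ r ∈ R, ∀ t,
    (∀ a, cls a = t → a.src ∉ r ∧ a.tgt ∈ r) ∨
    (∀ a, cls a = t → a.src ∈ r ∧ a.tgt ∉ r) ∨
    (∀ a, cls a = t → (a.src ∈ r ↔ a.tgt ∈ r))
  ssp : ∀ s s', s ≠ s' → ∃ r ∈ R, (s ∈ r ∧ s' ∉ r) ∨ (s ∉ r ∧ s' ∈ r)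
  essp : ∀ t s, (∀ a, cls a = t → a.src ≠ s) → ∃ r ∈ R, s ∉ r ∧
    ((∀ a, cls a = t → a.src ∈ r ∧ a.tgt ∉ r) ∨ (∀ a, cls a = t → a.src ∈ r ∧ a.tgt ∈ r))

namespace Synthesis

section

variable {Lab : Type u} {A : LTS Lab}

def Enters (S : Synthesis A) (t : S.T) (r : Set A.State) : Prop :=
  ∀ a, S.cls a = t → a.src ∉ r ∧ a.tgt ∈ r

def Leaves (S : Synthesis A) (t : S.T) (r : Set A.State) : Prop :=
  ∀ a, S.cls a = t → a.src ∈ r ∧ a.tgt ∉ r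

def Inside (S : Synthesis A) (t : S.T) (r : Set A.State) : Prop :=
  ∀ a, S.cls a = t → a.src ∈ r ∧ a.tgt ∈ r

end

section

variable {Var D Lbl : Type u} {M : ReactiveModule Var D Lbl}

open Classical in
/-- The synthesized net. -/
noncomputable def net (S : Synthesis M.toLTS) : Net Lbl where
  Place := S.R
  Trans := S.T
  pre t := {r | S.Leaves t r.1 ∨ S.Inside t r.1}
  post t := {r | S.Enters t r.1 ∨ S.Inside t r.1}
  read _ := ∅
  init r := if M.init ∈ r.1 then 1 else 0
  label := S.lab

/-- The region of the states in which the internal variable `x` has the value `d`. -/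
def varRegion (_S : Synthesis M.toLTS) (x : M.X) (d : D) : Set M.toLTS.State :=
  {q | M.val q x = d}

open Classical in
/-- The synthesized net enriched with places for the values of the internal variables, attached
to the transitions that change these values. -/
noncomputable def varNet (S : Synthesis M.toLTS) : Net Lbl where
  Place := S.net.Place ⊕ (M.X × D)
  Trans := S.T
  pre t := {p | Sum.elim (fun r => r ∈ S.net.pre t)
    (fun c => S.Leaves t (S.varRegion c.1 c.2)) p}
  post t := {p | Sum.elim (fun r => r ∈ S.net.post t)
    (fun c => S.Enters t (S.varRegion c.1 c.2)) p}
  read _ := ∅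
  init := Sum.elim S.net.init (fun c => if M.val M.init c.1 = c.2 then 1 else 0)
  label := S.lab

/-- The valuations of the external variables under which `t` can occur. -/
def guard (S : Synthesis M.toLTS) (t : S.T) : Set (M.I → D) :=
  {v | ∃ a, S.cls a = t ∧ M.Tr a.src v a.lab a.tgt}

/-- The external variables on which `t` depends: changing the value of any other one never
affects whether `t` can occur. -/
def dep (S : Synthesis M.toLTS) (t : S.T) : Set M.I :=
  {i | ¬ ∀ v ∈ S.guard t, ∀ w : M.I → D, (∀ j, j ≠ i → w j = v j) → w ∈ S.guard t}

/-- The admissible valuations of the variables on which `t` depends. -/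
def admissible (S : Synthesis M.toLTS) (t : S.T) : Set (S.dep t → D) :=
  {w | ∃ v ∈ S.guard t, ∀ i, w i = v i.1}

/-- Transitions of the agent net: `t_val` for an admissible `val`, and the transitions that change
the value of an external variable from `j` to `k`. -/
inductive IntTrans (S : Synthesis M.toLTS) : Type u
  | core (t : S.T) (w : S.admissible t) : IntTrans S
  | ext (i : M.I) (j k : D) (h : j ≠ k) : IntTrans S

open Classical in
/-- The agent net: the places for the values of external variables are added, with a free
circulation of tokens among the values of each variable, and read by the original transitions. -/
noncomputable def intNet (S : Synthesis M.toLTS) (init : M.I → D) : Net Lbl where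
  Place := S.varNet.Place ⊕ (M.I × D)
  Trans := S.IntTrans
  pre
    | .core t _ => Sum.inl '' S.varNet.pre t
    | .ext i j _ _ => {Sum.inr (i, j)}
  post
    | .core t _ => Sum.inl '' S.varNet.post t
    | .ext i _ k _ => {Sum.inr (i, k)}
  read
    | .core _ w => {p | ∃ i, p = Sum.inr (i.1, w.1 i)}
    | .ext _ _ _ _ => ∅
  init := Sum.elim S.varNet.init (fun c => if init c.1 = c.2 then 1 else 0)
  label
    | .core t _ => S.lab t
    | .ext _ _ _ _ => ∅

/-- The agent net with its components for the internal and for the external variables. -/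
noncomputable def agentNet (S : Synthesis M.toLTS) (init : M.I → D) : INet Var D Lbl where
  toNet := S.intNet init
  IntComp := M.X
  intVar x := x.1
  ExtComp := M.I
  extVar y := y.1
  port
    | .inl x, d => Sum.inl (Sum.inr (x, d))
    | .inr y, d => Sum.inr (y, d)
  port_inj {c c' d d'} h := by
    rcases c with x | y <;> rcases c' with x' | y'
    · obtain ⟨h1, h2⟩ := Prod.mk.inj (Sum.inr.inj (Sum.inl.inj h))
      exact ⟨congrArg Sum.inl h1, h2⟩
    · cases h
    · cases h
    · obtain ⟨h1, h2⟩ := Prod.mk.inj (Sum.inr.inj h)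
      exact ⟨congrArg Sum.inr h1, h2⟩

/-- The valuations of the external variables under which a net transition can occur are the same
for all the arcs that it represents. -/
def UniformGuards (S : Synthesis M.toLTS) : Prop :=
  ∀ a b, S.cls a = S.cls b → ∀ v, M.Tr a.src v a.lab a.tgt ↔ M.Tr b.src v b.lab b.tgt

end

end Synthesis

/-! ### Global models -/

/-- The module obtained by composing the modules `M 0, …, M n` with synchronization on data. -/
noncomputable def globalModule {Var D Lbl : Type u} :
    (n : ℕ) → (Fin (n + 1) → ReactiveModule Var D Lbl) → ReactiveModule Var D Lbl
  | 0, M => M 0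
  | n + 1, M => (globalModule n fun i => M i.castSucc).par (M (Fin.last (n + 1)))

/-- The net obtained by composing the agent nets by fusion of sequential components. -/
noncomputable def globalNet {Var D Lbl : Type u} :
    (n : ℕ) → (M : Fin (n + 1) → ReactiveModule Var D Lbl) →
      (∀ i, Synthesis (M i).toLTS) → (∀ i, (M i).I → D) → INet Var D Lbl
  | 0, _, S, init => (S 0).agentNet (init 0)
  | n + 1, M, S, init =>
    (globalNet n (fun i => M i.castSucc) (fun i => S i.castSucc) fun i => init i.castSucc).fuse
      ((S (Fin.last (n + 1))).agentNet (init (Fin.last (n + 1))))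

end MAS

namespace MAS

/-! ### Embeddings of transition systems and their reachable parts. -/

namespace LTS

variable {Lab : Type u} {A B : LTS Lab} {f : A.State → B.State}

/-! The proof carries an invariant, `Represents`, between a net and a module that may still have
external variables. A module state together with an external valuation is encoded by a set of marked
places: external components depend on the valuation alone, all other places on the state alone.
Every net transition is either a pure move of one external token or internal, and the internal ones
simulate the module transitions in both directions.

Agent nets satisfy the invariant (`agentNetRepresents`). State separation makes the encoding
injective, and event-state separation yields an arc from the current state for every enabled core
transition. A guard is determined by the finitely many variables on which it depends, so the
activators test exactly the guard. A net transition pools the guards of its arcs, however: the arc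
found at the current state may itself be impossible under the current valuation. The agent condition
then provides a transition between the same states, possibly with another label. Hence the graph is
always preserved, the labels only under uniform guards; the parameter `U` of the invariant keeps
track of this.

Fusion preserves the invariant (`INet.Represents.fuse`). The composition of total modules is an
interleaving in which each module reads the internal variables of the other (`par_tr_iff`). Gluing
external moves to an internal transition adds nothing to it, because their places are renamed to
places it already has (`liftsLeft_of_glued`). No internal transition is lost, because every change
of an external value is available as a partner (`exists_liftsLeft`).

In the end no external variables remain. The encoding then embeds the closure into the markings,
preserving and reflecting steps, and uses only the values 0 and 1. -/

/-- The image of `f` contains the initial state and is closed under steps, each of which lifts to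
`A`; so paths can be lifted and pushed forward by induction on their length. -/
theorem reachable_iff_exists (hinit : B.init = f A.init)
    (hf : ∀ x m, B.Step (f x) m ↔ ∃ y, m = f y ∧ A.Step x y) (m : B.State) :
    B.Reachable m ↔ ∃ x, m = f x ∧ A.Reachable x := by
  constructor
  · intro h
    induction h with
    | refl => exact ⟨A.init, hinit, .refl⟩
    | tail _ h ih =>
      obtain ⟨x, rfl, hx⟩ := ih
      obtain ⟨y, rfl, hy⟩ := (hf _ _).1 h
      exact ⟨y, rfl, hx.tail hy⟩
  · rintro ⟨x, rfl, hx⟩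
    induction hx with
    | refl => exact hinit ▸ .refl
    | tail _ h ih => exact ih.tail ((hf _ _).2 ⟨_, rfl, h⟩)

/-- A step-reflecting injection identifies the reachable parts of two transition systems. -/
noncomputable def reachableEquiv (hinj : Function.Injective f) (hinit : B.init = f A.init)
    (hf : ∀ x m, B.Step (f x) m ↔ ∃ y, m = f y ∧ A.Step x y) :
    A.reachablePart.State ≃ B.reachablePart.State :=
  Equiv.ofBijective
    (fun x => ⟨f x.1, (reachable_iff_exists hinit hf _).2 ⟨x.1, rfl, x.2⟩⟩)
    ⟨fun x y h => Subtype.ext (hinj (congrArg Subtype.val h)), fun m => by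
      obtain ⟨x, hx, hr⟩ := (reachable_iff_exists hinit hf _).1 m.2
      exact ⟨⟨x, hr⟩, Subtype.ext hx.symm⟩⟩

theorem nonempty_graphIso (hinj : Function.Injective f) (hinit : B.init = f A.init)
    (hf : ∀ x m, B.Step (f x) m ↔ ∃ y, m = f y ∧ A.Step x y) :
    Nonempty (GraphIso B.reachablePart A.reachablePart) := by
  let e := reachableEquiv hinj hinit hf
  refine ⟨⟨e.symm, ?_, fun s s' => ?_⟩⟩
  · rw [Equiv.symm_apply_eq]
    exact Subtype.ext hinit
  · obtain ⟨x, rfl⟩ := e.surjective s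
    obtain ⟨y, rfl⟩ := e.surjective s'
    rw [e.symm_apply_apply, e.symm_apply_apply]
    refine (hf x.1 (f y.1)).trans ⟨?_, fun h => ⟨_, rfl, h⟩⟩
    rintro ⟨z, hz, h⟩
    obtain rfl := hinj hz
    exact h

theorem nonempty_iso (hinj : Function.Injective f) (hinit : B.init = f A.init)
    (hf : ∀ x a m, B.Tr (f x) a m ↔ ∃ y, m = f y ∧ A.Tr x a y) :
    Nonempty (Iso B.reachablePart A.reachablePart) := by
  have hf' : ∀ x m, B.Step (f x) m ↔ ∃ y, m = f y ∧ A.Step x y := by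
    intro x m
    simp only [Step, hf]
    exact ⟨fun ⟨a, y, h, h'⟩ => ⟨y, h, a, h'⟩, fun ⟨y, h, a, h'⟩ => ⟨a, y, h, h'⟩⟩
  let e := reachableEquiv hinj hinit hf'
  refine ⟨⟨e.symm, ?_, fun s a s' => ?_⟩⟩
  · rw [Equiv.symm_apply_eq]
    exact Subtype.ext hinit
  · obtain ⟨x, rfl⟩ := e.surjective s
    obtain ⟨y, rfl⟩ := e.surjective s'
    rw [e.symm_apply_apply, e.symm_apply_apply]
    refine (hf x.1 a (f y.1)).trans ⟨?_, fun h => ⟨_, rfl, h⟩⟩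
    rintro ⟨z, hz, h⟩
    obtain rfl := hinj hz
    exact h

end LTS

/-! ### Safe markings and contact-free firing. -/

namespace Net

variable {Lbl : Type u}

open Classical in
/-- The marking with one token on every place in `m`. -/
noncomputable def indicator (N : Net Lbl) (m : N.Place → Prop) : N.Place → ℕ :=
  fun p => if m p then 1 else 0

theorem indicator_eq_iff {N : Net Lbl} {m m' : N.Place → Prop} :
    N.indicator m = N.indicator m' ↔ ∀ p, m p ↔ m' p := by
  refine ⟨fun h p => ?_, fun h => ?_⟩
  · have := congrFun h p
    unfold indicator at this
    split_ifs at this <;> simp_all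
  · rw [funext fun p => propext (h p)]

theorem enabled_indicator {N : Net Lbl} {m : N.Place → Prop} {t : N.Trans} :
    N.Enabled (N.indicator m) t ↔ ∀ p ∈ N.pre t ∪ N.read t, m p := by
  refine forall₂_congr fun p _ => ?_
  unfold indicator
  split_ifs <;> simp_all

/-- The transition `t` can occur at the safe marking `m`, without contact, and leads to `m'`. -/
structure Occurs (N : Net Lbl) (m m' : N.Place → Prop) (t : N.Trans) : Prop where
  enabled : ∀ p ∈ N.pre t ∪ N.read t, m p
  contact_free : ∀ p ∈ N.post t, p ∉ N.pre t → ¬ m p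
  effect : ∀ p, m' p ↔ p ∈ N.post t ∨ p ∉ N.pre t ∧ m p

/-- Truncated subtraction is harmless since consumed tokens are present, and no place gets a second
token since there is no contact. A place that is both pre- and postcondition keeps its token. -/
theorem Occurs.fire_eq {N : Net Lbl} {m m' : N.Place → Prop} {t : N.Trans}
    (h : N.Occurs m m' t) : N.fire (N.indicator m) t = N.indicator m' := by
  funext p
  have h1 := h.enabled p
  have h2 := h.contact_free p
  have h3 := h.effect p
  simp only [fire, indicator, Set.mem_sdiff, Set.mem_union] at *
  by_cases hp : p ∈ N.pre t <;> by_cases hq : p ∈ N.post t <;> by_cases hm : m p <;>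
    simp_all

end Net

/-! ### The invariant relating nets and modules. -/

namespace INet

variable {Var D Lbl : Type u}

/-- The only effect of `t` is to move the token of the external component `c` from `j` to `k`. -/
structure IsExtMove (N : INet Var D Lbl) (t : N.Trans) (c : N.ExtComp) (j k : D) : Prop where
  pre_eq : N.pre t = {N.port (.inr c) j}
  post_eq : N.post t = {N.port (.inr c) k}
  read_eq : N.read t = ∅
  label_eq : N.label t = ∅

/-- `t` touches no external component and moves at most one token in every internal one. -/
structure Internal (N : INet Var D Lbl) (t : N.Trans) : Prop where
  not_pre : ∀ c d, N.port (.inr c) d ∉ N.pre t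
  not_post : ∀ c d, N.port (.inr c) d ∉ N.post t
  moves : ∀ c, (∀ d, N.port (.inl c) d ∉ N.pre t ∧ N.port (.inl c) d ∉ N.post t) ∨
    ∃ j k, j ≠ k ∧ ∀ d, (N.port (.inl c) d ∈ N.pre t ↔ d = j) ∧
      (N.port (.inl c) d ∈ N.post t ↔ d = k)

/-- The marking `mark s v` of the net `N` encodes the state `s` of the module `M` and the
valuation `v` of its external variables, in such a way that the transitions of `N` that do not
merely change the value of an external component simulate those of `M`, and conversely. Labels are
only required to be preserved by the first simulation if `U` holds. -/
structure Represents (U : Prop) (N : INet Var D Lbl) (M : ReactiveModule Var D Lbl) where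
  int_inj : Function.Injective N.intVar
  int_mem : ∀ c, N.intVar c ∈ M.X
  int_surj : ∀ x ∈ M.X, ∃ c, N.intVar c = x
  ext_mem : ∀ c, N.extVar c ∈ M.I
  mark : M.State → (M.I → D) → N.Place → Prop
  mark_int : ∀ s v c d, mark s v (N.port (.inl c) d) ↔ M.val s ⟨N.intVar c, int_mem c⟩ = d
  mark_ext : ∀ s v c d, mark s v (N.port (.inr c) d) ↔ v ⟨N.extVar c, ext_mem c⟩ = d
  mark_indep : ∀ s v v' p, (∀ c d, p ≠ N.port (.inr c) d) → (mark s v p ↔ mark s v' p)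
  mark_inj : ∀ s s' v, (∀ p, mark s v p ↔ mark s' v p) → s = s'
  init_eq : ∀ v p, (∀ c d, p ≠ N.port (.inr c) d) →
    N.init p = N.indicator (mark M.init v) p
  total : ∀ s v, ∃ a s', M.Tr s v a s'
  ext_exists : ∀ c j k, j ≠ k → ∃ t, N.IsExtMove t c j k
  trans : ∀ t, (∃ c j k, j ≠ k ∧ N.IsExtMove t c j k) ∨ N.Internal t ∧
    ∀ s v, (∀ p ∈ N.pre t ∪ N.read t, mark s v p) →
      ∃ s', N.Occurs (mark s v) (mark s' v) t ∧ (∃ b, M.Tr s v b s') ∧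
        (U → M.Tr s v (N.label t) s')
  complete : ∀ {s v a s'}, M.Tr s v a s' →
    ∃ t, N.Internal t ∧ N.label t = a ∧ N.Occurs (mark s v) (mark s' v) t

end INet

/-! ### Agent nets satisfy the invariant. -/

namespace Synthesis

variable {Var D Lbl : Type u} {M : ReactiveModule Var D Lbl} (S : Synthesis M.toLTS)

/-- Pass from `v` to `w` by changing one variable at a time, which takes finitely many changes. A
change at a variable in `dep` is void by hypothesis; any other change stays inside the guard by
definition of `dep`. -/
theorem mem_guard_of_eqOn_dep {t : S.T} {v w : M.I → D} (hv : v ∈ S.guard t)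
    (h : ∀ i ∈ S.dep t, w i = v i) : w ∈ S.guard t := by
  classical
  have : Finite M.I := M.I_finite
  have : Fintype M.I := Fintype.ofFinite _
  suffices H : ∀ s : Finset M.I, (fun i => if i ∈ s then w i else v i) ∈ S.guard t by
    simpa using H Finset.univ
  intro s
  induction s using Finset.induction_on with
  | empty => simpa using hv
  | insert i s hi ih =>
    by_cases hd : i ∈ S.dep t
    · convert ih using 2 with j
      by_cases hj : j = i
      · subst hj; simp [hi, h j hd]
      · simp [hj]
    · refine not_not.1 hd _ ih _ fun j hj => ?_
      simp [hj]

/-- Arcs of one class have the same label, and in an agent the label determines the valuations at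
both ends. So a single arc decides for the whole class, and the value sets behave like regions. -/
theorem leaves_varRegion_iff (hM : M.IsAgent) (a : M.toLTS.Arc) (x : M.X) (d : D) :
    S.Leaves (S.cls a) (S.varRegion x d) ↔ M.val a.src x = d ∧ M.val a.tgt x ≠ d := by
  refine ⟨fun h => h a rfl, fun h b hb => ?_⟩
  obtain ⟨v, ha⟩ := a.tr
  obtain ⟨w, hw⟩ := b.tr
  rw [← S.lab_cls, hb, S.lab_cls] at hw
  obtain ⟨h1, h2, -⟩ := hM.label ha hw
  simpa only [varRegion, Set.mem_ofPred_eq, ← h1, ← h2] using h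

theorem enters_varRegion_iff (hM : M.IsAgent) (a : M.toLTS.Arc) (x : M.X) (d : D) :
    S.Enters (S.cls a) (S.varRegion x d) ↔ M.val a.src x ≠ d ∧ M.val a.tgt x = d := by
  refine ⟨fun h => h a rfl, fun h b hb => ?_⟩
  obtain ⟨v, ha⟩ := a.tr
  obtain ⟨w, hw⟩ := b.tr
  rw [← S.lab_cls, hb, S.lab_cls] at hw
  obtain ⟨h1, h2, -⟩ := hM.label ha hw
  simpa only [varRegion, Set.mem_ofPred_eq, ← h1, ← h2] using h

/-- The places of the agent net that are marked in a state and under an external valuation. -/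
def mark (v₀ : M.I → D) (s : M.State) (v : M.I → D) : (S.agentNet v₀).Place → Prop :=
  Sum.elim (Sum.elim (fun r => s ∈ r.1) fun c => M.val s c.1 = c.2) fun c => v c.1 = c.2

theorem internal_core (hM : M.IsAgent) (v₀ : M.I → D) (t : S.T) (w : S.admissible t) :
    (S.agentNet v₀).Internal (.core t w) := by
  obtain ⟨a, rfl⟩ := S.cls_surjective t
  refine ⟨fun c d => ?_, fun c d => ?_, fun x => ?_⟩
  · rintro ⟨p, -, hp⟩
    cases hp
  · rintro ⟨p, -, hp⟩
    cases hp
  · have h1 : ∀ d, (S.agentNet v₀).port (.inl x) d ∈ (S.agentNet v₀).pre (.core (S.cls a) w) ↔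
        M.val a.src x = d ∧ M.val a.tgt x ≠ d := fun d =>
      (Sum.inl_injective.mem_set_image).trans (S.leaves_varRegion_iff hM a x d)
    have h2 : ∀ d, (S.agentNet v₀).port (.inl x) d ∈ (S.agentNet v₀).post (.core (S.cls a) w) ↔
        M.val a.src x ≠ d ∧ M.val a.tgt x = d := fun d =>
      (Sum.inl_injective.mem_set_image).trans (S.enters_varRegion_iff hM a x d)
    simp only [h1, h2]
    by_cases h : M.val a.src x = M.val a.tgt x
    · left
      intro d
      rw [h]
      tauto
    · refine .inr ⟨M.val a.src x, M.val a.tgt x, h, fun d => ⟨⟨fun h' => h'.1.symm, ?_⟩,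
        ⟨fun h' => h'.2.symm, ?_⟩⟩⟩
      · rintro rfl
        exact ⟨rfl, Ne.symm h⟩
      · rintro rfl
        exact ⟨h, rfl⟩

theorem occurs_core (hM : M.IsAgent) (v₀ : M.I → D) (a : M.toLTS.Arc)
    (w : S.admissible (S.cls a)) (v : M.I → D) (hv : ∀ i, w.1 i = v i.1) :
    (S.agentNet v₀).Occurs (S.mark v₀ a.src v) (S.mark v₀ a.tgt v) (.core (S.cls a) w) := by
  have e1 : ∀ p, Sum.inl p ∈ (S.agentNet v₀).pre (.core (S.cls a) w) ↔
      p ∈ S.varNet.pre (S.cls a) := fun p => Sum.inl_injective.mem_set_image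
  have e2 : ∀ p, Sum.inl p ∈ (S.agentNet v₀).post (.core (S.cls a) w) ↔
      p ∈ S.varNet.post (S.cls a) := fun p => Sum.inl_injective.mem_set_image
  refine ⟨?_, ?_, ?_⟩
  · rintro p (⟨(r | c), hp, rfl⟩ | ⟨i, rfl⟩)
    · rcases hp with h | h <;> exact (h a rfl).1
    · exact (hp a rfl).1
    · exact (hv i).symm
  · rintro _ ⟨(r | c), hp, rfl⟩ hq
    · rcases hp with h | h
      · exact (h a rfl).1
      · exact (hq ((e1 _).2 (.inr h))).elim
    · exact (hp a rfl).1
  · rintro ((r | c) | c)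
    · refine Iff.trans ?_ (or_congr (e2 _) (and_congr (not_congr (e1 _)) Iff.rfl)).symm
      change a.tgt ∈ r.1 ↔ (S.Enters (S.cls a) r.1 ∨ S.Inside (S.cls a) r.1) ∨
        ¬ (S.Leaves (S.cls a) r.1 ∨ S.Inside (S.cls a) r.1) ∧ a.src ∈ r.1
      have hL : S.Leaves (S.cls a) r.1 → a.tgt ∉ r.1 := fun h => (h a rfl).2
      have hE : S.Enters (S.cls a) r.1 → a.tgt ∈ r.1 := fun h => (h a rfl).2
      have hI : S.Inside (S.cls a) r.1 → a.tgt ∈ r.1 := fun h => (h a rfl).2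
      rcases S.region r.1 r.2 (S.cls a) with h | h | h
      · exact iff_of_true (h a rfl).2 (.inl (.inl h))
      · exact iff_of_false (h a rfl).2 (by
          rintro ((h' | h') | h')
          · exact hL h (hE h')
          · exact hL h (hI h')
          · exact h'.1 (.inl h))
      -- If the region is not crossed but does not contain all arcs of the class, its place is not
      -- attached to the transition and keeps whatever token it has.
      · have := h a rfl
        tauto
    · refine Iff.trans ?_ (or_congr (e2 _) (and_congr (not_congr (e1 _)) Iff.rfl)).symm
      change M.val a.tgt c.1 = c.2 ↔ S.Enters (S.cls a) (S.varRegion c.1 c.2) ∨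
        ¬ S.Leaves (S.cls a) (S.varRegion c.1 c.2) ∧ M.val a.src c.1 = c.2
      rw [S.enters_varRegion_iff hM, S.leaves_varRegion_iff hM]
      tauto
    · refine ⟨fun h => .inr ⟨?_, h⟩, ?_⟩
      · rintro ⟨p, -, hp⟩
        cases hp
      · rintro (⟨p, -, hp⟩ | h)
        · cases hp
        · exact h.2

/-- This is event-state separation read contrapositively: without an arc from `s`, some precondition
of `t` would be a region that misses `s`. The activators force the second part. -/
theorem exists_arc_of_enabled (v₀ : M.I → D) (t : S.T) (w : S.admissible t) (s : M.State)
    (v : M.I → D)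
    (h : ∀ p ∈ (S.agentNet v₀).pre (.core t w) ∪ (S.agentNet v₀).read (.core t w),
      S.mark v₀ s v p) :
    (∃ a, S.cls a = t ∧ a.src = s) ∧ ∀ i, w.1 i = v i.1 := by
  refine ⟨?_, fun i => (h _ (.inr ⟨i, rfl⟩)).symm⟩
  by_contra! hs
  obtain ⟨r, hr, hsr, hr'⟩ := S.essp t s hs
  exact hsr (h (Sum.inl (Sum.inl ⟨r, hr⟩)) (.inl ⟨_, hr', rfl⟩))

/-- The agent net represents the module of the agent. -/
def agentNetRepresents (hM : M.IsAgent) (v₀ : M.I → D) {U : Prop} (hU : U → S.UniformGuards) :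
    INet.Represents U (S.agentNet v₀) M where
  int_inj := Subtype.val_injective
  int_mem c := c.2
  int_surj x hx := ⟨⟨x, hx⟩, rfl⟩
  ext_mem c := c.2
  mark := S.mark v₀
  mark_int _ _ _ _ := Iff.rfl
  mark_ext _ _ _ _ := Iff.rfl
  mark_indep s v v' p hp := by
    rcases p with (r | c) | c
    · rfl
    · rfl
    · exact (hp c.1 c.2 rfl).elim
  mark_inj s s' v h := by
    by_contra hs
    obtain ⟨r, hr, hr'⟩ := S.ssp s s' hs
    have : s ∈ r ↔ s' ∈ r := h (Sum.inl (Sum.inl ⟨r, hr⟩))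
    tauto
  init_eq v p hp := by
    rcases p with (r | c) | c
    · rfl
    · rfl
    · exact (hp c.1 c.2 rfl).elim
  total := hM.total
  ext_exists c j k h := ⟨.ext c j k h, rfl, rfl, rfl, rfl⟩
  trans t := by
    rcases t with ⟨t, w⟩ | ⟨i, j, k, h⟩
    · refine .inr ⟨S.internal_core hM v₀ t w, fun s v h => ?_⟩
      obtain ⟨⟨a, rfl, rfl⟩, hw⟩ := S.exists_arc_of_enabled v₀ t w s v h
      obtain ⟨v', hv', hw'⟩ := w.2
      -- The arc `b` that admits `v` need not be the arc `a` that starts in `s`; they only share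
      -- their class, hence their label.
      obtain ⟨b, hb, hbv⟩ := S.mem_guard_of_eqOn_dep hv' (w := v) fun i hi =>
        (hw ⟨i, hi⟩).symm.trans (hw' ⟨i, hi⟩)
      refine ⟨a.tgt, S.occurs_core hM v₀ a w v hw, ?_, fun hu => ?_⟩
      -- The agent condition moves the valuation `v` from `b` to the end points of `a`, at the cost
      -- of an uncontrolled label.
      · obtain ⟨v₁, ha⟩ := a.tr
        rw [← S.lab_cls, hb, S.lab_cls] at hbv
        exact (hM.label ha hbv).2.2.1
      · change M.Tr a.src v (S.lab (S.cls a)) a.tgt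
        rw [S.lab_cls]
        exact (hU hu b a hb v).1 hbv
    · exact .inl ⟨i, j, k, h, rfl, rfl, rfl, rfl⟩
  complete {s v a s'} h := by
    let b : M.toLTS.Arc := ⟨s, a, s', v, h⟩
    refine ⟨.core (S.cls b) ⟨fun i => v i.1, v, ⟨b, rfl, h⟩, fun _ => rfl⟩,
      S.internal_core hM v₀ _ _, S.lab_cls b, S.occurs_core hM v₀ b _ v fun _ => rfl⟩

end Synthesis

/-! ### Composition on data as interleaving. -/

namespace ReactiveModule

variable {Var D Lbl : Type u} {M₁ M₂ : ReactiveModule Var D Lbl}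

open Classical in
/-- The valuation of the external variables of `M₁` in a state of `M₁.par M₂`. -/
noncomputable def leftVal (s : M₂.State) (v : (M₁.par M₂).I → D) : M₁.I → D := fun y =>
  if h : y.1 ∈ M₂.X then M₂.val s ⟨y.1, h⟩
  else v ⟨y.1, .inl y.2, fun h' => h'.elim (M₁.disj.notMem_of_mem_right y.2) h⟩

open Classical in
/-- The valuation of the external variables of `M₂` in a state of `M₁.par M₂`. -/
noncomputable def rightVal (s : M₁.State) (v : (M₁.par M₂).I → D) : M₂.I → D := fun y =>
  if h : y.1 ∈ M₁.X then M₁.val s ⟨y.1, h⟩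
  else v ⟨y.1, .inr y.2, fun h' => h'.elim h (M₂.disj.notMem_of_mem_right y.2)⟩

theorem leftVal_of_mem (s : M₂.State) (v : (M₁.par M₂).I → D) (y : M₁.I) (h : y.1 ∈ M₂.X) :
    leftVal s v y = M₂.val s ⟨y.1, h⟩ := dif_pos h

theorem leftVal_of_mem_ext (s : M₂.State) (v : (M₁.par M₂).I → D) (y : M₁.I)
    (h : y.1 ∈ (M₁.par M₂).I) : leftVal s v y = v ⟨y.1, h⟩ :=
  dif_neg fun h' => h.2 (.inr h')

theorem rightVal_of_mem (s : M₁.State) (v : (M₁.par M₂).I → D) (y : M₂.I) (h : y.1 ∈ M₁.X) :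
    rightVal s v y = M₁.val s ⟨y.1, h⟩ := dif_pos h

theorem rightVal_of_mem_ext (s : M₁.State) (v : (M₁.par M₂).I → D) (y : M₂.I)
    (h : y.1 ∈ (M₁.par M₂).I) : rightVal s v y = v ⟨y.1, h⟩ :=
  dif_neg fun h' => h.2 (.inl h')

theorem par_val_of_mem_left (s : (M₁.par M₂).State) (x : (M₁.par M₂).X) (h : x.1 ∈ M₁.X) :
    (M₁.par M₂).val s x = M₁.val s.1 ⟨x.1, h⟩ := dif_pos h

theorem par_val_of_notMem_left (s : (M₁.par M₂).State) (x : (M₁.par M₂).X) (h : x.1 ∉ M₁.X) :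
    (M₁.par M₂).val s x = M₂.val s.2 ⟨x.1, x.2.resolve_left h⟩ := dif_neg h

/-- Compatibility forces both local valuations: a variable external to one module is either internal
to the other, whose state gives its value, or still external to the composition. The idle module
must offer some transition under its forced valuation, and totality guarantees one. -/
theorem par_tr_iff (h₁ : ∀ s v, ∃ a s', M₁.Tr s v a s') (h₂ : ∀ s v, ∃ a s', M₂.Tr s v a s')
    (s : (M₁.par M₂).State) (v : (M₁.par M₂).I → D) (a : Set Lbl) (s' : (M₁.par M₂).State) :
    (M₁.par M₂).Tr s v a s' ↔
      (M₁.Tr s.1 (leftVal s.2 v) a s'.1 ∧ s'.2 = s.2) ∨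
      (M₂.Tr s.2 (rightVal s.1 v) a s'.2 ∧ s'.1 = s.1) := by
  have c₀ : Compat (leftVal (M₁ := M₁) s.2 v) (rightVal (M₂ := M₂) s.1 v) := by
    intro y hy hz
    -- A variable external to both modules is internal to neither, so it stays external and both
    -- sides read it from `v`.
    have hy' : y ∈ (M₁.par M₂).I := ⟨.inl hy, fun h => h.elim
      (M₁.disj.notMem_of_mem_right hy) (M₂.disj.notMem_of_mem_right hz)⟩
    rw [leftVal_of_mem_ext _ _ _ hy', rightVal_of_mem_ext _ _ _ hy']
  have c₁ : Compat (M₁.val s.1) (rightVal (M₂ := M₂) s.1 v) := fun y hy hz =>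
    (rightVal_of_mem _ _ ⟨y, hz⟩ hy).symm
  have c₂ : Compat (M₂.val s.2) (leftVal (M₁ := M₁) s.2 v) := fun y hy hz =>
    (leftVal_of_mem _ _ ⟨y, hz⟩ hy).symm
  have c₃ : Compat v (leftVal (M₁ := M₁) s.2 v) := fun y hy hz =>
    (leftVal_of_mem_ext _ _ ⟨y, hz⟩ hy).symm
  have c₄ : Compat v (rightVal (M₂ := M₂) s.1 v) := fun y hy hz =>
    (rightVal_of_mem_ext _ _ ⟨y, hz⟩ hy).symm
  constructor
  · rintro ⟨α₁, α₂, a₁, a₂, q₁, q₂, t₁, t₂, -, k₁, k₂, k₃, k₄, h⟩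
    have e₁ : α₁ = leftVal s.2 v := by
      funext y
      by_cases hy : y.1 ∈ M₂.X
      · rw [leftVal_of_mem _ _ _ hy]
        exact (k₂ y.1 hy y.2).symm
      · have hy' : y.1 ∈ (M₁.par M₂).I :=
          ⟨.inl y.2, fun h => h.elim (M₁.disj.notMem_of_mem_right y.2) hy⟩
        rw [leftVal_of_mem_ext _ _ _ hy']
        exact (k₃ y.1 hy' y.2).symm
    have e₂ : α₂ = rightVal s.1 v := by
      funext y
      by_cases hy : y.1 ∈ M₁.X
      · rw [rightVal_of_mem _ _ _ hy]
        exact (k₁ y.1 hy y.2).symm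
      · have hy' : y.1 ∈ (M₁.par M₂).I :=
          ⟨.inr y.2, fun h => h.elim hy (M₂.disj.notMem_of_mem_right y.2)⟩
        rw [rightVal_of_mem_ext _ _ _ hy']
        exact (k₄ y.1 hy' y.2).symm
    subst e₁ e₂
    rcases h with ⟨rfl, rfl⟩ | ⟨rfl, rfl⟩
    · exact .inl ⟨t₁, rfl⟩
    · exact .inr ⟨t₂, rfl⟩
  · rcases s' with ⟨s₁', s₂'⟩
    rintro (⟨t₁, h⟩ | ⟨t₂, h⟩)
    · obtain ⟨a₂, q₂, t₂⟩ := h₂ s.2 (rightVal s.1 v)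
      exact ⟨_, _, a, a₂, s₁', q₂, t₁, t₂, c₀, c₁, c₂, c₃, c₄, .inl ⟨rfl, Prod.ext rfl h⟩⟩
    · obtain ⟨a₁, q₁, t₁⟩ := h₁ s.1 (leftVal s.2 v)
      exact ⟨_, _, a₁, a, q₁, s₂', t₁, t₂, c₀, c₁, c₂, c₃, c₄, .inr ⟨rfl, Prod.ext h rfl⟩⟩

end ReactiveModule

/-! ### Names of places in the fusion. -/

namespace INet

open ReactiveModule

variable {Var D Lbl : Type u} {N₁ N₂ : INet Var D Lbl}

@[simp]
theorem compEquiv_port (N N' : INet Var D Lbl) (c : N.IntComp ⊕ N.ExtComp)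
    (c' : N'.IntComp ⊕ N'.ExtComp) (d : D) (h : N.port c d ∈ N.comp c) :
    (compEquiv N N' c c' ⟨N.port c d, h⟩).1 = N'.port c' d := by
  have : (Equiv.ofInjective _ (N.port_injective c)).symm ⟨N.port c d, h⟩ = d :=
    (Equiv.symm_apply_eq _).2 rfl
  exact congrArg (N'.port c') this

theorem kept_inl_iff {p : N₁.Place} : (fusionData N₁ N₂).Kept (Sum.inl p) ↔
    ∀ c d b, p = N₁.port (.inr c) d → N₂.intVar b ≠ N₁.extVar c := by
  constructor
  · rintro h c d b rfl hb
    refine h ⟨Set.mem_iUnion.2 ⟨⟨(b, c), hb⟩, d, rfl⟩, fun h' => ?_⟩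
    obtain ⟨i, d', h'⟩ := Set.mem_iUnion.1 h'
    cases (N₁.port_inj h').1
  · rintro h ⟨h', -⟩
    obtain ⟨i, d, rfl⟩ := Set.mem_iUnion.1 h'
    exact h _ _ _ rfl i.2

theorem kept_inr_iff {p : N₂.Place} : (fusionData N₁ N₂).Kept (Sum.inr p) ↔
    ∀ c d b, p = N₂.port (.inr c) d → N₁.intVar b ≠ N₂.extVar c := by
  constructor
  · rintro h c d b rfl hb
    refine h ⟨Set.mem_iUnion.2 ⟨⟨(b, c), hb⟩, d, rfl⟩, fun h' => ?_⟩
    obtain ⟨i, d', h'⟩ := Set.mem_iUnion.1 h'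
    cases (N₂.port_inj h').1
  · rintro h ⟨h', -⟩
    obtain ⟨i, d, rfl⟩ := Set.mem_iUnion.1 h'
    exact h _ _ _ rfl i.2

/-- A description of the renaming of places in the fusion of two nets in terms of ports. -/
theorem names_iff {p : (fusionData N₁ N₂).FPlace} {p' : N₁.Place ⊕ N₂.Place} :
    (fusionData N₁ N₂).Names p p' ↔ p.1 = p' ∨
      (∃ c₁ c₂ d, N₁.intVar c₁ = N₂.extVar c₂ ∧ p.1 = Sum.inl (N₁.port (.inl c₁) d) ∧
        p' = Sum.inr (N₂.port (.inr c₂) d)) ∨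
      (∃ c₂ c₁ d, N₂.intVar c₂ = N₁.extVar c₁ ∧ p.1 = Sum.inr (N₂.port (.inl c₂) d) ∧
        p' = Sum.inl (N₁.port (.inr c₁) d)) := by
  refine or_congr Iff.rfl ⟨?_, ?_⟩
  · rintro ⟨-, ⟨i, ⟨_, d, rfl⟩, h, h'⟩ | ⟨i, ⟨_, d, rfl⟩, h, h'⟩⟩
    · exact .inl ⟨i.1.1, i.1.2, d, i.2, h, h'.trans (congrArg Sum.inr (compEquiv_port ..))⟩
    · exact .inr ⟨i.1.1, i.1.2, d, i.2, h, h'.trans (congrArg Sum.inl (compEquiv_port ..))⟩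
  · rintro (⟨c₁, c₂, d, hc, h, rfl⟩ | ⟨c₂, c₁, d, hc, h, rfl⟩)
    · refine ⟨fun hk => kept_inr_iff.1 hk _ _ _ rfl hc, .inl ⟨⟨(c₁, c₂), hc⟩, ⟨_, d, rfl⟩, h, ?_⟩⟩
      exact congrArg Sum.inr (compEquiv_port ..).symm
    · refine ⟨fun hk => kept_inl_iff.1 hk _ _ _ rfl hc, .inr ⟨⟨(c₂, c₁), hc⟩, ⟨_, d, rfl⟩, h, ?_⟩⟩
      exact congrArg Sum.inl (compEquiv_port ..).symm

theorem names_iff_of_kept {p : (fusionData N₁ N₂).FPlace} {p' : N₁.Place ⊕ N₂.Place}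
    (h : (fusionData N₁ N₂).Kept p') : (fusionData N₁ N₂).Names p p' ↔ p.1 = p' :=
  ⟨fun hp => hp.resolve_right fun hp => hp.1 h, .inl⟩

theorem exists_names (p' : N₁.Place ⊕ N₂.Place) : ∃ p, (fusionData N₁ N₂).Names p p' := by
  by_cases hk : (fusionData N₁ N₂).Kept p'
  · exact ⟨⟨p', hk⟩, .inl rfl⟩
  rcases p' with p | p
  · simp only [kept_inl_iff, not_forall, not_not] at hk
    obtain ⟨c, d, b, rfl, h⟩ := hk
    exact ⟨(fuse N₁ N₂).port (.inl (.inr b)) d, names_iff.2 (.inr (.inr ⟨b, c, d, h, rfl, rfl⟩))⟩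
  · simp only [kept_inr_iff, not_forall, not_not] at hk
    obtain ⟨c, d, b, rfl, h⟩ := hk
    exact ⟨(fuse N₁ N₂).port (.inl (.inl b)) d, names_iff.2 (.inr (.inl ⟨b, c, d, h, rfl, rfl⟩))⟩

/-! ### Transitions of the fusion. -/

theorem Internal.kept_inl_of_mem_pre {t : N₁.Trans} (ht : N₁.Internal t) {p : N₁.Place}
    (hp : p ∈ N₁.pre t) : (fusionData N₁ N₂).Kept (Sum.inl p) :=
  kept_inl_iff.2 fun c d _ h => (ht.not_pre c d (h ▸ hp)).elim

theorem Internal.kept_inl_of_mem_post {t : N₁.Trans} (ht : N₁.Internal t) {p : N₁.Place}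
    (hp : p ∈ N₁.post t) : (fusionData N₁ N₂).Kept (Sum.inl p) :=
  kept_inl_iff.2 fun c d _ h => (ht.not_post c d (h ▸ hp)).elim

theorem Internal.kept_inr_of_mem_pre {t : N₂.Trans} (ht : N₂.Internal t) {p : N₂.Place}
    (hp : p ∈ N₂.pre t) : (fusionData N₁ N₂).Kept (Sum.inr p) :=
  kept_inr_iff.2 fun c d _ h => (ht.not_pre c d (h ▸ hp)).elim

theorem Internal.kept_inr_of_mem_post {t : N₂.Trans} (ht : N₂.Internal t) {p : N₂.Place}
    (hp : p ∈ N₂.post t) : (fusionData N₁ N₂).Kept (Sum.inr p) :=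
  kept_inr_iff.2 fun c d _ h => (ht.not_post c d (h ▸ hp)).elim

/-- The transition `t` of the fusion acts like the transition `t₁` of the first net. -/
structure LiftsLeft (t : (fuse N₁ N₂).Trans) (t₁ : N₁.Trans) : Prop where
  mem_pre : ∀ p, p ∈ (fuse N₁ N₂).pre t ↔ ∃ p' ∈ N₁.pre t₁, p.1 = Sum.inl p'
  mem_post : ∀ p, p ∈ (fuse N₁ N₂).post t ↔ ∃ p' ∈ N₁.post t₁, p.1 = Sum.inl p'
  mem_read : ∀ p, p ∈ (fuse N₁ N₂).read t ↔
    ∃ p' ∈ N₁.read t₁, (fusionData N₁ N₂).Names p (Sum.inl p')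
  label_eq : (fuse N₁ N₂).label t = N₁.label t₁

/-- The transition `t` of the fusion acts like the transition `t₂` of the second net. -/
structure LiftsRight (t : (fuse N₁ N₂).Trans) (t₂ : N₂.Trans) : Prop where
  mem_pre : ∀ p, p ∈ (fuse N₁ N₂).pre t ↔ ∃ p' ∈ N₂.pre t₂, p.1 = Sum.inr p'
  mem_post : ∀ p, p ∈ (fuse N₁ N₂).post t ↔ ∃ p' ∈ N₂.post t₂, p.1 = Sum.inr p'
  mem_read : ∀ p, p ∈ (fuse N₁ N₂).read t ↔
    ∃ p' ∈ N₂.read t₂, (fusionData N₁ N₂).Names p (Sum.inr p')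
  label_eq : (fuse N₁ N₂).label t = N₂.label t₂

/-- The glued partners make the same move in a component identified with one that `t₁` moves. After
renaming, their places are already attached to `t₁`, and they have no activators or labels of their
own. -/
theorem liftsLeft_of_glued (hinj : Function.Injective N₁.intVar) {t₁ : N₁.Trans}
    (ht₁ : N₁.Internal t₁) {t : (fuse N₁ N₂).Trans} (h₁ : t.1.1 = {t₁})
    (h₂ : ∀ t₂ ∈ t.1.2, ∃ c₁ c₂ j k, N₁.intVar c₁ = N₂.extVar c₂ ∧
      N₁.port (.inl c₁) j ∈ N₁.pre t₁ ∧ N₁.port (.inl c₁) k ∈ N₁.post t₁ ∧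
      N₂.IsExtMove t₂ c₂ j k) : LiftsLeft t t₁ := by
  -- Injectivity of `intVar` makes the internal component identified with `c₂` unique, so the
  -- removed place has only one name.
  have key : ∀ {p : (fusionData N₁ N₂).FPlace} {c₁ c₂ d}, N₁.intVar c₁ = N₂.extVar c₂ →
      (fusionData N₁ N₂).Names p (Sum.inr (N₂.port (.inr c₂) d)) →
      p.1 = Sum.inl (N₁.port (.inl c₁) d) := by
    intro p c₁ c₂ d hc hp
    rcases names_iff.1 hp with h | ⟨c, c', d', hc', h, h'⟩ | ⟨_, _, _, _, _, h'⟩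
    · exact (kept_inr_iff.1 (h ▸ p.2) _ _ _ rfl hc).elim
    · obtain ⟨e, rfl⟩ := N₂.port_inj (Sum.inr.inj h')
      obtain rfl := Sum.inr.inj e
      obtain rfl := hinj (hc.trans hc'.symm)
      exact h
    · cases h'
  refine ⟨fun p => ⟨?_, ?_⟩, fun p => ⟨?_, ?_⟩, fun p => ⟨?_, ?_⟩, ?_⟩
  · rintro (⟨x, hx, p', hp', hn⟩ | ⟨x, hx, p', hp', hn⟩)
    · rw [h₁] at hx
      obtain rfl := hx
      exact ⟨p', hp', (names_iff_of_kept (ht₁.kept_inl_of_mem_pre hp')).1 hn⟩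
    · obtain ⟨c₁, c₂, j, k, hc, hj, hk, hm⟩ := h₂ x hx
      rw [hm.pre_eq] at hp'
      obtain rfl := hp'
      exact ⟨_, hj, key hc hn⟩
  · rintro ⟨p', hp', h⟩
    exact .inl ⟨t₁, h₁ ▸ rfl, p', hp', .inl h⟩
  · rintro (⟨x, hx, p', hp', hn⟩ | ⟨x, hx, p', hp', hn⟩)
    · rw [h₁] at hx
      obtain rfl := hx
      exact ⟨p', hp', (names_iff_of_kept (ht₁.kept_inl_of_mem_post hp')).1 hn⟩
    · obtain ⟨c₁, c₂, j, k, hc, hj, hk, hm⟩ := h₂ x hx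
      rw [hm.post_eq] at hp'
      obtain rfl := hp'
      exact ⟨_, hk, key hc hn⟩
  · rintro ⟨p', hp', h⟩
    exact .inl ⟨t₁, h₁ ▸ rfl, p', hp', .inl h⟩
  · rintro (⟨x, hx, p', hp', hn⟩ | ⟨x, hx, p', hp', hn⟩)
    · rw [h₁] at hx
      obtain rfl := hx
      exact ⟨p', hp', hn⟩
    · obtain ⟨c₁, c₂, j, k, -, -, -, hm⟩ := h₂ x hx
      rw [hm.read_eq] at hp'
      exact hp'.elim
  · rintro ⟨p', hp', h⟩
    exact .inl ⟨t₁, h₁ ▸ rfl, p', hp', h⟩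
  · change (⋃ x ∈ t.1.1, N₁.label x) ∪ (⋃ x ∈ t.1.2, N₂.label x) = _
    have : (⋃ x ∈ t.1.2, N₂.label x) = ∅ := by
      simp only [Set.iUnion_eq_empty]
      intro x hx
      obtain ⟨c₁, c₂, j, k, -, -, -, hm⟩ := h₂ x hx
      exact hm.label_eq
    rw [this, h₁, Set.union_empty, Set.biUnion_singleton]

theorem liftsRight_of_glued (hinj : Function.Injective N₂.intVar) {t₂ : N₂.Trans}
    (ht₂ : N₂.Internal t₂) {t : (fuse N₁ N₂).Trans} (h₂ : t.1.2 = {t₂})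
    (h₁ : ∀ t₁ ∈ t.1.1, ∃ c₂ c₁ j k, N₂.intVar c₂ = N₁.extVar c₁ ∧
      N₂.port (.inl c₂) j ∈ N₂.pre t₂ ∧ N₂.port (.inl c₂) k ∈ N₂.post t₂ ∧
      N₁.IsExtMove t₁ c₁ j k) : LiftsRight t t₂ := by
  have key : ∀ {p : (fusionData N₁ N₂).FPlace} {c₂ c₁ d}, N₂.intVar c₂ = N₁.extVar c₁ →
      (fusionData N₁ N₂).Names p (Sum.inl (N₁.port (.inr c₁) d)) →
      p.1 = Sum.inr (N₂.port (.inl c₂) d) := by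
    intro p c₂ c₁ d hc hp
    rcases names_iff.1 hp with h | ⟨_, _, _, _, _, h'⟩ | ⟨c, c', d', hc', h, h'⟩
    · exact (kept_inl_iff.1 (h ▸ p.2) _ _ _ rfl hc).elim
    · cases h'
    · obtain ⟨e, rfl⟩ := N₁.port_inj (Sum.inl.inj h')
      obtain rfl := Sum.inr.inj e
      obtain rfl := hinj (hc.trans hc'.symm)
      exact h
  refine ⟨fun p => ⟨?_, ?_⟩, fun p => ⟨?_, ?_⟩, fun p => ⟨?_, ?_⟩, ?_⟩
  · rintro (⟨x, hx, p', hp', hn⟩ | ⟨x, hx, p', hp', hn⟩)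
    · obtain ⟨c₂, c₁, j, k, hc, hj, hk, hm⟩ := h₁ x hx
      rw [hm.pre_eq] at hp'
      obtain rfl := hp'
      exact ⟨_, hj, key hc hn⟩
    · rw [h₂] at hx
      obtain rfl := hx
      exact ⟨p', hp', (names_iff_of_kept (ht₂.kept_inr_of_mem_pre hp')).1 hn⟩
  · rintro ⟨p', hp', h⟩
    exact .inr ⟨t₂, h₂ ▸ rfl, p', hp', .inl h⟩
  · rintro (⟨x, hx, p', hp', hn⟩ | ⟨x, hx, p', hp', hn⟩)
    · obtain ⟨c₂, c₁, j, k, hc, hj, hk, hm⟩ := h₁ x hx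
      rw [hm.post_eq] at hp'
      obtain rfl := hp'
      exact ⟨_, hk, key hc hn⟩
    · rw [h₂] at hx
      obtain rfl := hx
      exact ⟨p', hp', (names_iff_of_kept (ht₂.kept_inr_of_mem_post hp')).1 hn⟩
  · rintro ⟨p', hp', h⟩
    exact .inr ⟨t₂, h₂ ▸ rfl, p', hp', .inl h⟩
  · rintro (⟨x, hx, p', hp', hn⟩ | ⟨x, hx, p', hp', hn⟩)
    · obtain ⟨c₂, c₁, j, k, -, -, -, hm⟩ := h₁ x hx
      rw [hm.read_eq] at hp'
      exact hp'.elim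
    · rw [h₂] at hx
      obtain rfl := hx
      exact ⟨p', hp', hn⟩
  · rintro ⟨p', hp', h⟩
    exact .inr ⟨t₂, h₂ ▸ rfl, p', hp', h⟩
  · change (⋃ x ∈ t.1.1, N₁.label x) ∪ (⋃ x ∈ t.1.2, N₂.label x) = _
    have : (⋃ x ∈ t.1.1, N₁.label x) = ∅ := by
      simp only [Set.iUnion_eq_empty]
      intro x hx
      obtain ⟨c₂, c₁, j, k, -, -, -, hm⟩ := h₁ x hx
      exact hm.label_eq
    rw [this, h₂, Set.empty_union, Set.biUnion_singleton]

/-- Every transition is internal or changes the value of an external component, and all changes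
of external components are possible. -/
structure HasExtMoves (N : INet Var D Lbl) : Prop where
  int_inj : Function.Injective N.intVar
  ext_exists : ∀ c j k, j ≠ k → ∃ t, N.IsExtMove t c j k
  trans : ∀ t, (∃ c j k, j ≠ k ∧ N.IsExtMove t c j k) ∨ N.Internal t

theorem HasExtMoves.isExtMove_of_mem {N : INet Var D Lbl} (h : N.HasExtMoves) {t : N.Trans}
    {c : N.ExtComp} {j k : D} (hj : N.port (.inr c) j ∈ N.pre t)
    (hk : N.port (.inr c) k ∈ N.post t) : N.IsExtMove t c j k := by
  rcases h.trans t with ⟨c', j', k', -, hm⟩ | ht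
  · have hj' := hj
    have hk' := hk
    rw [hm.pre_eq] at hj'
    rw [hm.post_eq] at hk'
    obtain ⟨e, rfl⟩ := N.port_inj hj'
    obtain ⟨-, rfl⟩ := N.port_inj hk'
    obtain rfl := Sum.inr.inj e
    exact hm
  · exact (ht.not_pre _ _ hj).elim

theorem HasExtMoves.internal_of_mem {N : INet Var D Lbl} (h : N.HasExtMoves) {t : N.Trans}
    {c : N.IntComp} {j : D} (hj : N.port (.inl c) j ∈ N.pre t) : N.Internal t := by
  rcases h.trans t with ⟨c', j', k', -, hm⟩ | ht
  · rw [hm.pre_eq] at hj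
    cases (N.port_inj hj).1
  · exact ht

theorem mem_glueR (E₂ : N₂.HasExtMoves) {t₁ : N₁.Trans} {p q : N₁.Place} {t₂ : N₂.Trans}
    (h : t₂ ∈ (fusionData N₁ N₂).glueR t₁ p q) :
    ∃ c₁ c₂ j k, N₁.intVar c₁ = N₂.extVar c₂ ∧ N₁.port (.inl c₁) j ∈ N₁.pre t₁ ∧
      N₁.port (.inl c₁) k ∈ N₁.post t₁ ∧ N₂.IsExtMove t₂ c₂ j k := by
  obtain ⟨i, ⟨j, rfl⟩, ⟨k, rfl⟩, h₁, h₂, h₃, h₄⟩ := h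
  refine ⟨i.1.1, i.1.2, j, k, i.2, (Set.singleton_subset_iff.1 h₁.ge).2,
    (Set.singleton_subset_iff.1 h₂.ge).2,
    E₂.isExtMove_of_mem ?_ ?_⟩
  · rwa [← compEquiv_port N₁ N₂ (.inl i.1.1) (.inr i.1.2) j ⟨j, rfl⟩]
  · rwa [← compEquiv_port N₁ N₂ (.inl i.1.1) (.inr i.1.2) k ⟨k, rfl⟩]

theorem mem_glueL (E₁ : N₁.HasExtMoves) {t₂ : N₂.Trans} {p q : N₂.Place} {t₁ : N₁.Trans}
    (h : t₁ ∈ (fusionData N₁ N₂).glueL t₂ p q) :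
    ∃ c₂ c₁ j k, N₂.intVar c₂ = N₁.extVar c₁ ∧ N₂.port (.inl c₂) j ∈ N₂.pre t₂ ∧
      N₂.port (.inl c₂) k ∈ N₂.post t₂ ∧ N₁.IsExtMove t₁ c₁ j k := by
  obtain ⟨i, ⟨j, rfl⟩, ⟨k, rfl⟩, h₁, h₂, h₃, h₄⟩ := h
  refine ⟨i.1.1, i.1.2, j, k, i.2, (Set.singleton_subset_iff.1 h₁.ge).2,
    (Set.singleton_subset_iff.1 h₂.ge).2,
    E₁.isExtMove_of_mem ?_ ?_⟩
  · rwa [← compEquiv_port N₂ N₁ (.inl i.1.1) (.inr i.1.2) j ⟨j, rfl⟩]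
  · rwa [← compEquiv_port N₂ N₁ (.inl i.1.1) (.inr i.1.2) k ⟨k, rfl⟩]

/-- If `t₁` uses no place of an identified component as a precondition, it may stay alone. Otherwise
choose any identified component that it moves, say from `j` to `k`: since `j ≠ k`, the other net has
a matching external move, so the glueing set is nonempty. The choice of component is immaterial. -/
theorem exists_liftsLeft (E₁ : N₁.HasExtMoves) (E₂ : N₂.HasExtMoves) {t₁ : N₁.Trans}
    (ht₁ : N₁.Internal t₁) : ∃ t : (fuse N₁ N₂).Trans, LiftsLeft t t₁ := by
  by_cases hp : N₁.pre t₁ ∩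
      ((⋃ i, (fusionData N₁ N₂).X₁ i) ∪ ⋃ i, (fusionData N₁ N₂).X₁' i) = ∅
  · exact ⟨⟨({t₁}, ∅), .inr (.inr (.inl ⟨t₁, rfl, .inl hp⟩))⟩,
      liftsLeft_of_glued E₁.int_inj ht₁ rfl fun _ h => h.elim⟩
  obtain ⟨p, hp, h | h⟩ := Set.nonempty_iff_ne_empty.2 hp
  · obtain ⟨⟨⟨c₁, c₂⟩, hc⟩, d, rfl⟩ := Set.mem_iUnion.1 h
    rcases ht₁.moves c₁ with h | ⟨j, k, hjk, h⟩
    · exact ((h d).1 hp).elim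
    obtain ⟨t₂, ht₂⟩ := E₂.ext_exists c₂ j k hjk
    have hg : ((fusionData N₁ N₂).glueR t₁ (N₁.port (.inl c₁) j)
        (N₁.port (.inl c₁) k)).Nonempty := by
      refine ⟨t₂, ⟨(c₁, c₂), hc⟩, ⟨j, rfl⟩, ⟨k, rfl⟩, ?_, ?_, ?_, ?_⟩
      · ext x
        constructor
        · rintro ⟨⟨d, rfl⟩, hx⟩
          rw [(h d).1.1 hx]
          rfl
        · rintro rfl
          exact ⟨⟨j, rfl⟩, (h j).1.2 rfl⟩
      · ext x
        constructor
        · rintro ⟨⟨d, rfl⟩, hx⟩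
          rw [(h d).2.1 hx]
          rfl
        · rintro rfl
          exact ⟨⟨k, rfl⟩, (h k).2.2 rfl⟩
      · rw [ht₂.pre_eq]
        exact compEquiv_port N₁ N₂ (.inl c₁) (.inr c₂) j _
      · rw [ht₂.post_eq]
        exact compEquiv_port N₁ N₂ (.inl c₁) (.inr c₂) k _
    exact ⟨⟨_, .inl ⟨t₁, _, _, rfl, hg⟩⟩,
      liftsLeft_of_glued E₁.int_inj ht₁ rfl fun x hx => mem_glueR E₂ hx⟩
  · obtain ⟨i, d, rfl⟩ := Set.mem_iUnion.1 h
    exact (ht₁.not_pre _ _ hp).elim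

theorem exists_liftsRight (E₁ : N₁.HasExtMoves) (E₂ : N₂.HasExtMoves) {t₂ : N₂.Trans}
    (ht₂ : N₂.Internal t₂) : ∃ t : (fuse N₁ N₂).Trans, LiftsRight t t₂ := by
  by_cases hp : N₂.pre t₂ ∩
      ((⋃ i, (fusionData N₁ N₂).X₂ i) ∪ ⋃ i, (fusionData N₁ N₂).X₂' i) = ∅
  · exact ⟨⟨(∅, {t₂}), .inr (.inr (.inr ⟨t₂, rfl, .inl hp⟩))⟩,
      liftsRight_of_glued E₂.int_inj ht₂ rfl fun _ h => h.elim⟩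
  obtain ⟨p, hp, h | h⟩ := Set.nonempty_iff_ne_empty.2 hp
  · obtain ⟨i, d, rfl⟩ := Set.mem_iUnion.1 h
    exact (ht₂.not_pre _ _ hp).elim
  · obtain ⟨⟨⟨c₂, c₁⟩, hc⟩, d, rfl⟩ := Set.mem_iUnion.1 h
    rcases ht₂.moves c₂ with h | ⟨j, k, hjk, h⟩
    · exact ((h d).1 hp).elim
    obtain ⟨t₁, ht₁⟩ := E₁.ext_exists c₁ j k hjk
    have hg : ((fusionData N₁ N₂).glueL t₂ (N₂.port (.inl c₂) j)
        (N₂.port (.inl c₂) k)).Nonempty := by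
      refine ⟨t₁, ⟨(c₂, c₁), hc⟩, ⟨j, rfl⟩, ⟨k, rfl⟩, ?_, ?_, ?_, ?_⟩
      · ext x
        constructor
        · rintro ⟨⟨d, rfl⟩, hx⟩
          rw [(h d).1.1 hx]
          rfl
        · rintro rfl
          exact ⟨⟨j, rfl⟩, (h j).1.2 rfl⟩
      · ext x
        constructor
        · rintro ⟨⟨d, rfl⟩, hx⟩
          rw [(h d).2.1 hx]
          rfl
        · rintro rfl
          exact ⟨⟨k, rfl⟩, (h k).2.2 rfl⟩
      · rw [ht₁.pre_eq]
        exact compEquiv_port N₂ N₁ (.inl c₂) (.inr c₁) j _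
      · rw [ht₁.post_eq]
        exact compEquiv_port N₂ N₁ (.inl c₂) (.inr c₁) k _
    exact ⟨⟨_, .inr (.inl ⟨t₂, _, _, rfl, hg⟩)⟩,
      liftsRight_of_glued E₂.int_inj ht₂ rfl fun x hx => mem_glueL E₁ hx⟩

theorem attached_left {f₁ : N₁.Trans → Set N₁.Place} {f₂ : N₂.Trans → Set N₂.Place}
    {t : (fusionData N₁ N₂).FTrans} {t₁ : N₁.Trans} (ht : t.1 = ({t₁}, ∅)) :
    (fusionData N₁ N₂).attached f₁ f₂ t =
      {p | ∃ p' ∈ f₁ t₁, (fusionData N₁ N₂).Names p (Sum.inl p')} := by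
  ext p
  simp [FusionData.attached, ht]

theorem attached_right {f₁ : N₁.Trans → Set N₁.Place} {f₂ : N₂.Trans → Set N₂.Place}
    {t : (fusionData N₁ N₂).FTrans} {t₂ : N₂.Trans} (ht : t.1 = (∅, {t₂})) :
    (fusionData N₁ N₂).attached f₁ f₂ t =
      {p | ∃ p' ∈ f₂ t₂, (fusionData N₁ N₂).Names p (Sum.inr p')} := by
  ext p
  simp [FusionData.attached, ht]

theorem isExtMove_left {t : (fuse N₁ N₂).Trans} {t₁ : N₁.Trans} (ht : t.1 = ({t₁}, ∅))
    {c : N₁.ExtComp} (hc : ∀ b, N₂.intVar b ≠ N₁.extVar c) {j k : D}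
    (h : N₁.IsExtMove t₁ c j k) : (fuse N₁ N₂).IsExtMove t (.inl ⟨c, hc⟩) j k := by
  have hn : ∀ d (p : (fusionData N₁ N₂).FPlace),
      (fusionData N₁ N₂).Names p (Sum.inl (N₁.port (.inr c) d)) ↔
        p = (fuse N₁ N₂).port (.inr (.inl ⟨c, hc⟩)) d := fun d p =>
    (names_iff_of_kept ((fuse N₁ N₂).port (.inr (.inl ⟨c, hc⟩)) d).2).trans Subtype.ext_iff.symm
  refine ⟨?_, ?_, ?_, ?_⟩
  · refine (attached_left ht).trans ?_
    ext p
    simp only [h.pre_eq, Set.mem_singleton_iff, exists_eq_left, hn]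
    rfl
  · refine (attached_left ht).trans ?_
    ext p
    simp only [h.post_eq, Set.mem_singleton_iff, exists_eq_left, hn]
    rfl
  · refine (attached_left ht).trans ?_
    simp only [h.read_eq, Set.mem_empty_iff_false, false_and, exists_false]
    rfl
  · change (⋃ x ∈ t.1.1, N₁.label x) ∪ (⋃ x ∈ t.1.2, N₂.label x) = _
    simp [ht, h.label_eq]

theorem isExtMove_right {t : (fuse N₁ N₂).Trans} {t₂ : N₂.Trans} (ht : t.1 = (∅, {t₂}))
    {c : N₂.ExtComp} (hc : ∀ b, N₁.intVar b ≠ N₂.extVar c) {j k : D}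
    (h : N₂.IsExtMove t₂ c j k) : (fuse N₁ N₂).IsExtMove t (.inr ⟨c, hc⟩) j k := by
  have hn : ∀ d (p : (fusionData N₁ N₂).FPlace),
      (fusionData N₁ N₂).Names p (Sum.inr (N₂.port (.inr c) d)) ↔
        p = (fuse N₁ N₂).port (.inr (.inr ⟨c, hc⟩)) d := fun d p =>
    (names_iff_of_kept ((fuse N₁ N₂).port (.inr (.inr ⟨c, hc⟩)) d).2).trans Subtype.ext_iff.symm
  refine ⟨?_, ?_, ?_, ?_⟩
  · refine (attached_right ht).trans ?_
    ext p
    simp only [h.pre_eq, Set.mem_singleton_iff, exists_eq_left, hn]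
    rfl
  · refine (attached_right ht).trans ?_
    ext p
    simp only [h.post_eq, Set.mem_singleton_iff, exists_eq_left, hn]
    rfl
  · refine (attached_right ht).trans ?_
    simp only [h.read_eq, Set.mem_empty_iff_false, false_and, exists_false]
    rfl
  · change (⋃ x ∈ t.1.1, N₁.label x) ∪ (⋃ x ∈ t.1.2, N₂.label x) = _
    simp [ht, h.label_eq]

theorem fuse_ext_exists (E₁ : N₁.HasExtMoves) (E₂ : N₂.HasExtMoves) (c : (fuse N₁ N₂).ExtComp)
    (j k : D) (hjk : j ≠ k) : ∃ t, (fuse N₁ N₂).IsExtMove t c j k := by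
  rcases c with ⟨c, hc⟩ | ⟨c, hc⟩
  · obtain ⟨t₁, h⟩ := E₁.ext_exists c j k hjk
    refine ⟨⟨({t₁}, ∅), .inr (.inr (.inl ⟨t₁, rfl, .inl ?_⟩))⟩, isExtMove_left rfl hc h⟩
    rw [h.pre_eq, Set.singleton_inter_eq_empty]
    rintro (h' | h') <;> obtain ⟨i, d, h'⟩ := Set.mem_iUnion.1 h'
    · cases (N₁.port_inj h').1
    · obtain rfl := Sum.inr.inj (N₁.port_inj h').1
      exact hc _ i.2
  · obtain ⟨t₂, h⟩ := E₂.ext_exists c j k hjk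
    refine ⟨⟨(∅, {t₂}), .inr (.inr (.inr ⟨t₂, rfl, .inl ?_⟩))⟩, isExtMove_right rfl hc h⟩
    rw [h.pre_eq, Set.singleton_inter_eq_empty]
    rintro (h' | h') <;> obtain ⟨i, d, h'⟩ := Set.mem_iUnion.1 h'
    · obtain rfl := Sum.inr.inj (N₂.port_inj h').1
      exact hc _ i.2
    · cases (N₂.port_inj h').1

theorem fuse_trans_cases (E₁ : N₁.HasExtMoves) (E₂ : N₂.HasExtMoves) (t : (fuse N₁ N₂).Trans) :
    (∃ c j k, j ≠ k ∧ (fuse N₁ N₂).IsExtMove t c j k) ∨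
      (∃ t₁, N₁.Internal t₁ ∧ LiftsLeft t t₁) ∨ ∃ t₂, N₂.Internal t₂ ∧ LiftsRight t t₂ := by
  obtain ⟨U, ⟨t₁, p, q, rfl, x, hx⟩ | ⟨t₂, p, q, rfl, x, hx⟩ | ⟨t₁, rfl, h⟩ | ⟨t₂, rfl, h⟩⟩ := t
  · obtain ⟨c₁, c₂, j, k, -, hj, -⟩ := mem_glueR E₂ hx
    have ht₁ := E₁.internal_of_mem hj
    exact .inr (.inl ⟨t₁, ht₁, liftsLeft_of_glued E₁.int_inj ht₁ rfl fun _ => mem_glueR E₂⟩)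
  · obtain ⟨c₂, c₁, j, k, -, hj, -⟩ := mem_glueL E₁ hx
    have ht₂ := E₂.internal_of_mem hj
    exact .inr (.inr ⟨t₂, ht₂, liftsRight_of_glued E₂.int_inj ht₂ rfl fun _ => mem_glueL E₁⟩)
  · rcases E₁.trans t₁ with ⟨c, j, k, hjk, hm⟩ | ht₁
    · refine .inl ⟨.inl ⟨c, fun b hb => ?_⟩, j, k, hjk, isExtMove_left rfl _ hm⟩
      -- If `c` were identified with an internal component, both places of the move would lie in
      -- fused components, and the transition could not stay alone.
      have hd : ∀ d, N₁.port (.inr c) d ∈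
          (⋃ i, (fusionData N₁ N₂).X₁ i) ∪ ⋃ i, (fusionData N₁ N₂).X₁' i := fun d =>
        .inr (Set.mem_iUnion.2 ⟨⟨(b, c), hb⟩, d, rfl⟩)
      rw [hm.pre_eq, hm.post_eq, Set.singleton_inter_eq_empty,
        Set.singleton_inter_eq_empty] at h
      exact h.elim (· (hd j)) (· (hd k))
    · exact .inr (.inl ⟨t₁, ht₁, liftsLeft_of_glued E₁.int_inj ht₁ rfl fun _ h => h.elim⟩)
  · rcases E₂.trans t₂ with ⟨c, j, k, hjk, hm⟩ | ht₂
    · refine .inl ⟨.inr ⟨c, fun b hb => ?_⟩, j, k, hjk, isExtMove_right rfl _ hm⟩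
      have hd : ∀ d, N₂.port (.inr c) d ∈
          (⋃ i, (fusionData N₁ N₂).X₂ i) ∪ ⋃ i, (fusionData N₁ N₂).X₂' i := fun d =>
        .inl (Set.mem_iUnion.2 ⟨⟨(b, c), hb⟩, d, rfl⟩)
      rw [hm.pre_eq, hm.post_eq, Set.singleton_inter_eq_empty,
        Set.singleton_inter_eq_empty] at h
      exact h.elim (· (hd j)) (· (hd k))
    · exact .inr (.inr ⟨t₂, ht₂, liftsRight_of_glued E₂.int_inj ht₂ rfl fun _ h => h.elim⟩)

theorem LiftsLeft.internal {t : (fuse N₁ N₂).Trans} {t₁ : N₁.Trans} (h : LiftsLeft t t₁)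
    (ht₁ : N₁.Internal t₁) : (fuse N₁ N₂).Internal t := by
  refine ⟨fun c d hp => ?_, fun c d hp => ?_, fun c => ?_⟩
  · obtain ⟨p', hp', e⟩ := (h.mem_pre _).1 hp
    rcases c with c | c
    · obtain rfl := Sum.inl.inj e
      exact ht₁.not_pre _ _ hp'
    · cases e
  · obtain ⟨p', hp', e⟩ := (h.mem_post _).1 hp
    rcases c with c | c
    · obtain rfl := Sum.inl.inj e
      exact ht₁.not_post _ _ hp'
    · cases e
  · simp only [h.mem_pre, h.mem_post]
    rcases c with c | c
    · have e : ∀ d, ((fuse N₁ N₂).port (.inl (.inl c)) d).1 = Sum.inl (N₁.port (.inl c) d) :=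
        fun _ => rfl
      simpa only [e, Sum.inl.injEq, exists_eq_right'] using ht₁.moves c
    · refine .inl fun d => ⟨?_, ?_⟩ <;> rintro ⟨p', -, e⟩ <;> cases e

theorem LiftsRight.internal {t : (fuse N₁ N₂).Trans} {t₂ : N₂.Trans} (h : LiftsRight t t₂)
    (ht₂ : N₂.Internal t₂) : (fuse N₁ N₂).Internal t := by
  refine ⟨fun c d hp => ?_, fun c d hp => ?_, fun c => ?_⟩
  · obtain ⟨p', hp', e⟩ := (h.mem_pre _).1 hp
    rcases c with c | c
    · cases e
    · obtain rfl := Sum.inr.inj e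
      exact ht₂.not_pre _ _ hp'
  · obtain ⟨p', hp', e⟩ := (h.mem_post _).1 hp
    rcases c with c | c
    · cases e
    · obtain rfl := Sum.inr.inj e
      exact ht₂.not_post _ _ hp'
  · simp only [h.mem_pre, h.mem_post]
    rcases c with c | c
    · refine .inl fun d => ⟨?_, ?_⟩ <;> rintro ⟨p', -, e⟩ <;> cases e
    · have e : ∀ d, ((fuse N₁ N₂).port (.inl (.inr c)) d).1 = Sum.inr (N₂.port (.inl c) d) :=
        fun _ => rfl
      simpa only [e, Sum.inr.injEq, exists_eq_right'] using ht₂.moves c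

end INet

open ReactiveModule

/-! ### Fusion preserves the invariant. -/

namespace INet.Represents

variable {Var D Lbl : Type u} {N₁ N₂ : INet Var D Lbl} {M₁ M₂ : ReactiveModule Var D Lbl}
  {U : Prop}

theorem hasExtMoves (R₁ : Represents U N₁ M₁) : N₁.HasExtMoves :=
  ⟨R₁.int_inj, R₁.ext_exists, fun t => (R₁.trans t).imp_right And.left⟩

theorem not_isExtMove_of_internal {t : N₁.Trans} (ht : N₁.Internal t) :
    ¬ ∃ c j k, j ≠ k ∧ N₁.IsExtMove t c j k := by
  rintro ⟨c, j, k, -, h⟩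
  exact ht.not_pre c j (h.pre_eq ▸ rfl)

/-- The marked places of two nets in a state of the composition of the modules. -/
def sumMark (R₁ : Represents U N₁ M₁) (R₂ : Represents U N₂ M₂) (s : (M₁.par M₂).State)
    (v : (M₁.par M₂).I → D) : N₁.Place ⊕ N₂.Place → Prop :=
  Sum.elim (R₁.mark s.1 (leftVal s.2 v)) (R₂.mark s.2 (rightVal s.1 v))

variable (R₁ : Represents U N₁ M₁) (R₂ : Represents U N₂ M₂)

/-- Identified places agree because `leftVal` and `rightVal` take the value of an identified
external variable from the state of the module that owns it. Hence activators may be tested before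
or after renaming. -/
theorem sumMark_iff_of_names {s : (M₁.par M₂).State} {v : (M₁.par M₂).I → D}
    {p : (fusionData N₁ N₂).FPlace} {p' : N₁.Place ⊕ N₂.Place}
    (h : (fusionData N₁ N₂).Names p p') :
    R₁.sumMark R₂ s v p.1 ↔ R₁.sumMark R₂ s v p' := by
  rcases names_iff.1 h with h | ⟨c₁, c₂, d, hc, h, h'⟩ | ⟨c₂, c₁, d, hc, h, h'⟩
  · rw [h]
  · rw [h, h']
    change R₁.mark _ _ _ ↔ R₂.mark _ _ _
    have hx : N₂.extVar c₂ ∈ M₁.X := hc ▸ R₁.int_mem c₁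
    rw [R₁.mark_int, R₂.mark_ext, rightVal_of_mem _ _ _ hx]
    simp only [hc]
  · rw [h, h']
    change R₂.mark _ _ _ ↔ R₁.mark _ _ _
    have hx : N₁.extVar c₁ ∈ M₂.X := hc ▸ R₂.int_mem c₂
    rw [R₂.mark_int, R₁.mark_ext, leftVal_of_mem _ _ _ hx]
    simp only [hc]

theorem ext_mem_par_left (R₁ : Represents U N₁ M₁)
    (R₂ : Represents U N₂ M₂) {c : N₁.ExtComp} (hc : ∀ b, N₂.intVar b ≠ N₁.extVar c) :
    N₁.extVar c ∈ (M₁.par M₂).I :=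
  ⟨.inl (R₁.ext_mem c), fun h => h.elim (M₁.disj.notMem_of_mem_right (R₁.ext_mem c)) fun h =>
    (R₂.int_surj _ h).elim hc⟩

theorem ext_mem_par_right (R₁ : Represents U N₁ M₁)
    (R₂ : Represents U N₂ M₂) {c : N₂.ExtComp} (hc : ∀ b, N₁.intVar b ≠ N₂.extVar c) :
    N₂.extVar c ∈ (M₁.par M₂).I :=
  ⟨.inr (R₂.ext_mem c), fun h => h.elim (fun h => (R₁.int_surj _ h).elim hc)
    (M₂.disj.notMem_of_mem_right (R₂.ext_mem c))⟩

/-- A surviving external place belongs to a variable that stays external, so its value comes from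
`v`; the other places of `N₁` depend on `s₁` only. Thus a step of one module leaves the surviving
places of the other net alone. -/
theorem sumMark_inl_congr (s₁ : M₁.State) (s₂ s₂' : M₂.State) (v : (M₁.par M₂).I → D)
    {p : N₁.Place} (hp : (fusionData N₁ N₂).Kept (Sum.inl p)) :
    R₁.sumMark R₂ (s₁, s₂) v (Sum.inl p) ↔ R₁.sumMark R₂ (s₁, s₂') v (Sum.inl p) := by
  change R₁.mark s₁ (leftVal s₂ v) p ↔ R₁.mark s₁ (leftVal s₂' v) p
  by_cases h : ∃ c d, p = N₁.port (.inr c) d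
  · obtain ⟨c, d, rfl⟩ := h
    have := ext_mem_par_left R₁ R₂ fun b => kept_inl_iff.1 hp c d b rfl
    rw [R₁.mark_ext, R₁.mark_ext, leftVal_of_mem_ext _ _ _ this, leftVal_of_mem_ext _ _ _ this]
  · push Not at h
    exact R₁.mark_indep _ _ _ _ h

theorem sumMark_inr_congr (s₁ s₁' : M₁.State) (s₂ : M₂.State) (v : (M₁.par M₂).I → D)
    {p : N₂.Place} (hp : (fusionData N₁ N₂).Kept (Sum.inr p)) :
    R₁.sumMark R₂ (s₁, s₂) v (Sum.inr p) ↔ R₁.sumMark R₂ (s₁', s₂) v (Sum.inr p) := by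
  change R₂.mark s₂ (rightVal s₁ v) p ↔ R₂.mark s₂ (rightVal s₁' v) p
  by_cases h : ∃ c d, p = N₂.port (.inr c) d
  · obtain ⟨c, d, rfl⟩ := h
    have := ext_mem_par_right R₁ R₂ fun b => kept_inr_iff.1 hp c d b rfl
    rw [R₂.mark_ext, R₂.mark_ext, rightVal_of_mem_ext _ _ _ this,
      rightVal_of_mem_ext _ _ _ this]
  · push Not at h
    exact R₂.mark_indep _ _ _ _ h

/-- The marked places of the fusion in a state of the composition of the modules. -/
def fuseMark (s : (M₁.par M₂).State) (v : (M₁.par M₂).I → D) : (fuse N₁ N₂).Place → Prop :=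
  fun p => R₁.sumMark R₂ s v p.1

variable {R₁ R₂} {t : (fuse N₁ N₂).Trans} {s₁ s₁' : M₁.State} {s₂ s₂' : M₂.State}
  {v : (M₁.par M₂).I → D} {t₁ : N₁.Trans} {t₂ : N₂.Trans}

theorem enabled_left (h : LiftsLeft t t₁) (ht₁ : N₁.Internal t₁) :
    (∀ p ∈ (fuse N₁ N₂).pre t ∪ (fuse N₁ N₂).read t, fuseMark R₁ R₂ (s₁, s₂) v p) ↔
      ∀ p ∈ N₁.pre t₁ ∪ N₁.read t₁, R₁.mark s₁ (leftVal s₂ v) p := by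
  constructor
  · rintro H p (hp | hp)
    · exact H ⟨Sum.inl p, ht₁.kept_inl_of_mem_pre hp⟩ (.inl ((h.mem_pre _).2 ⟨p, hp, rfl⟩))
    -- An activator may be a removed external place; it is then tested at the internal place that
    -- names it.
    · obtain ⟨q, hq⟩ := exists_names (N₂ := N₂) (Sum.inl p)
      exact (sumMark_iff_of_names R₁ R₂ hq).1 (H q (.inr ((h.mem_read _).2 ⟨p, hp, hq⟩)))
  · rintro H p (hp | hp)
    · obtain ⟨p', hp', e⟩ := (h.mem_pre _).1 hp
      change R₁.sumMark R₂ (s₁, s₂) v p.1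
      rw [e]
      exact H p' (.inl hp')
    · obtain ⟨p', hp', e⟩ := (h.mem_read _).1 hp
      exact (sumMark_iff_of_names R₁ R₂ e).2 (H p' (.inr hp'))

theorem enabled_right (h : LiftsRight t t₂) (ht₂ : N₂.Internal t₂) :
    (∀ p ∈ (fuse N₁ N₂).pre t ∪ (fuse N₁ N₂).read t, fuseMark R₁ R₂ (s₁, s₂) v p) ↔
      ∀ p ∈ N₂.pre t₂ ∪ N₂.read t₂, R₂.mark s₂ (rightVal s₁ v) p := by
  constructor
  · rintro H p (hp | hp)
    · exact H ⟨Sum.inr p, ht₂.kept_inr_of_mem_pre hp⟩ (.inl ((h.mem_pre _).2 ⟨p, hp, rfl⟩))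
    · obtain ⟨q, hq⟩ := exists_names (N₁ := N₁) (Sum.inr p)
      exact (sumMark_iff_of_names R₁ R₂ hq).1 (H q (.inr ((h.mem_read _).2 ⟨p, hp, hq⟩)))
  · rintro H p (hp | hp)
    · obtain ⟨p', hp', e⟩ := (h.mem_pre _).1 hp
      change R₁.sumMark R₂ (s₁, s₂) v p.1
      rw [e]
      exact H p' (.inl hp')
    · obtain ⟨p', hp', e⟩ := (h.mem_read _).1 hp
      exact (sumMark_iff_of_names R₁ R₂ e).2 (H p' (.inr hp'))

theorem occurs_left (h : LiftsLeft t t₁) (ht₁ : N₁.Internal t₁)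
    (ho : N₁.Occurs (R₁.mark s₁ (leftVal s₂ v)) (R₁.mark s₁' (leftVal s₂ v)) t₁) :
    (fuse N₁ N₂).Occurs (fuseMark R₁ R₂ (s₁, s₂) v) (fuseMark R₁ R₂ (s₁', s₂) v) t := by
  have mem_pre (p hk) : (⟨Sum.inl p, hk⟩ : (INet.fuse N₁ N₂).Place) ∈
        (INet.fuse N₁ N₂).pre t ↔
      p ∈ N₁.pre t₁ := (h.mem_pre _).trans (by simp)
  have mem_post (p hk) : (⟨Sum.inl p, hk⟩ : (INet.fuse N₁ N₂).Place) ∈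
        (INet.fuse N₁ N₂).post t ↔
      p ∈ N₁.post t₁ := (h.mem_post _).trans (by simp)
  refine ⟨(enabled_left h ht₁).2 ho.enabled, ?_, ?_⟩
  · rintro ⟨p, hk⟩ hp hq
    obtain ⟨p', hp', e⟩ := (h.mem_post _).1 hp
    obtain rfl : p = Sum.inl p' := e
    exact ho.contact_free p' hp' fun hp' => hq ((h.mem_pre _).2 ⟨p', hp', rfl⟩)
  · rintro ⟨p | p, hk⟩
    · exact (ho.effect p).trans
        (or_congr (mem_post p hk) (and_congr (not_congr (mem_pre p hk)) Iff.rfl)).symm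
    · have hp : (⟨Sum.inr p, hk⟩ : (INet.fuse N₁ N₂).Place) ∉
          (INet.fuse N₁ N₂).pre t := fun hp => by
        obtain ⟨_, -, e⟩ := (h.mem_pre _).1 hp
        cases e
      have hq : (⟨Sum.inr p, hk⟩ : (INet.fuse N₁ N₂).Place) ∉
          (INet.fuse N₁ N₂).post t := fun hp => by
        obtain ⟨_, -, e⟩ := (h.mem_post _).1 hp
        cases e
      exact (sumMark_inr_congr R₁ R₂ s₁' s₁ s₂ v hk).trans
        ⟨fun h => .inr ⟨hp, h⟩, fun h => (h.resolve_left hq).2⟩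

theorem occurs_right (h : LiftsRight t t₂) (ht₂ : N₂.Internal t₂)
    (ho : N₂.Occurs (R₂.mark s₂ (rightVal s₁ v)) (R₂.mark s₂' (rightVal s₁ v)) t₂) :
    (fuse N₁ N₂).Occurs (fuseMark R₁ R₂ (s₁, s₂) v) (fuseMark R₁ R₂ (s₁, s₂') v) t := by
  have mem_pre (p hk) : (⟨Sum.inr p, hk⟩ : (INet.fuse N₁ N₂).Place) ∈
        (INet.fuse N₁ N₂).pre t ↔
      p ∈ N₂.pre t₂ := (h.mem_pre _).trans (by simp)
  have mem_post (p hk) : (⟨Sum.inr p, hk⟩ : (INet.fuse N₁ N₂).Place) ∈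
        (INet.fuse N₁ N₂).post t ↔
      p ∈ N₂.post t₂ := (h.mem_post _).trans (by simp)
  refine ⟨(enabled_right h ht₂).2 ho.enabled, ?_, ?_⟩
  · rintro ⟨p, hk⟩ hp hq
    obtain ⟨p', hp', e⟩ := (h.mem_post _).1 hp
    obtain rfl : p = Sum.inr p' := e
    exact ho.contact_free p' hp' fun hp' => hq ((h.mem_pre _).2 ⟨p', hp', rfl⟩)
  · rintro ⟨p | p, hk⟩
    · have hp : (⟨Sum.inl p, hk⟩ : (INet.fuse N₁ N₂).Place) ∉
          (INet.fuse N₁ N₂).pre t := fun hp => by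
        obtain ⟨_, -, e⟩ := (h.mem_pre _).1 hp
        cases e
      have hq : (⟨Sum.inl p, hk⟩ : (INet.fuse N₁ N₂).Place) ∉
          (INet.fuse N₁ N₂).post t := fun hp => by
        obtain ⟨_, -, e⟩ := (h.mem_post _).1 hp
        cases e
      exact (sumMark_inl_congr R₁ R₂ s₁ s₂' s₂ v hk).trans
        ⟨fun h => .inr ⟨hp, h⟩, fun h => (h.resolve_left hq).2⟩
    · exact (ho.effect p).trans
        (or_congr (mem_post p hk) (and_congr (not_congr (mem_pre p hk)) Iff.rfl)).symm

/-- External places carry no information about the state, so the remaining places, all of which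
survive every fusion, already determine it. -/
theorem eq_of_mark_iff (R₁ : Represents U N₁ M₁) {s s' : M₁.State} {w w' : M₁.I → D}
    (h : ∀ p, (∀ c d, p ≠ N₁.port (.inr c) d) → (R₁.mark s w p ↔ R₁.mark s' w' p)) :
    s = s' := by
  refine R₁.mark_inj s s' w fun p => ?_
  by_cases hp : ∃ c d, p = N₁.port (.inr c) d
  · obtain ⟨c, d, rfl⟩ := hp
    rw [R₁.mark_ext, R₁.mark_ext]
  · push Not at hp
    exact (h p hp).trans (R₁.mark_indep _ _ _ _ hp)

/-- The fusion of two nets represents the composition of the modules that they represent. -/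
noncomputable def fuse (R₁ : Represents U N₁ M₁) (R₂ : Represents U N₂ M₂)
    (hX : Disjoint M₁.X M₂.X) : Represents U (INet.fuse N₁ N₂) (M₁.par M₂) where
  int_inj := by
    refine Function.Injective.sumElim R₁.int_inj R₂.int_inj fun a b h => ?_
    exact hX.le_bot ⟨R₁.int_mem a, h ▸ R₂.int_mem b⟩
  int_mem := by
    rintro (c | c)
    · exact .inl (R₁.int_mem c)
    · exact .inr (R₂.int_mem c)
  int_surj := by
    rintro x (hx | hx)
    · obtain ⟨c, rfl⟩ := R₁.int_surj x hx
      exact ⟨.inl c, rfl⟩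
    · obtain ⟨c, rfl⟩ := R₂.int_surj x hx
      exact ⟨.inr c, rfl⟩
  ext_mem := by
    rintro (⟨c, hc⟩ | ⟨c, hc⟩)
    · exact ext_mem_par_left R₁ R₂ hc
    · exact ext_mem_par_right R₁ R₂ hc
  mark := fuseMark R₁ R₂
  mark_int := by
    rintro s v (c | c) d
    · refine (R₁.mark_int _ _ _ _).trans (Eq.congr_left ?_)
      exact (par_val_of_mem_left s ⟨N₁.intVar c, .inl (R₁.int_mem c)⟩ (R₁.int_mem c)).symm
    · refine (R₂.mark_int _ _ _ _).trans (Eq.congr_left ?_)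
      exact (par_val_of_notMem_left s ⟨N₂.intVar c, .inr (R₂.int_mem c)⟩
        (hX.notMem_of_mem_right (R₂.int_mem c))).symm
  mark_ext := by
    rintro s v (⟨c, hc⟩ | ⟨c, hc⟩) d
    · refine (R₁.mark_ext _ _ _ _).trans (Eq.congr_left ?_)
      exact leftVal_of_mem_ext _ _ _ _
    · refine (R₂.mark_ext _ _ _ _).trans (Eq.congr_left ?_)
      exact rightVal_of_mem_ext _ _ _ _
  mark_indep := by
    rintro s v v' ⟨p | p, hk⟩ hp
    · exact R₁.mark_indep _ _ _ _ fun c d h =>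
        hp (.inl ⟨c, fun b => kept_inl_iff.1 hk c d b h⟩) d (Subtype.ext (congrArg Sum.inl h))
    · exact R₂.mark_indep _ _ _ _ fun c d h =>
        hp (.inr ⟨c, fun b => kept_inr_iff.1 hk c d b h⟩) d (Subtype.ext (congrArg Sum.inr h))
  mark_inj s s' v h := Prod.ext
    (R₁.eq_of_mark_iff fun p hp => h ⟨Sum.inl p, kept_inl_iff.2 fun c d _ h => (hp c d h).elim⟩)
    (R₂.eq_of_mark_iff fun p hp => h ⟨Sum.inr p, kept_inr_iff.2 fun c d _ h => (hp c d h).elim⟩)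
  init_eq := by
    rintro v ⟨p | p, hk⟩ hp
    -- A surviving place that is external in `N₁` would also be external in the fusion.
    · exact R₁.init_eq _ p fun c d h =>
        hp (.inl ⟨c, fun b => kept_inl_iff.1 hk c d b h⟩) d (Subtype.ext (congrArg Sum.inl h))
    · exact R₂.init_eq _ p fun c d h =>
        hp (.inr ⟨c, fun b => kept_inr_iff.1 hk c d b h⟩) d (Subtype.ext (congrArg Sum.inr h))
  total s v := by
    obtain ⟨a, s', h⟩ := R₁.total s.1 (leftVal s.2 v)
    exact ⟨a, (s', s.2), (par_tr_iff R₁.total R₂.total _ _ _ _).2 (.inl ⟨h, rfl⟩)⟩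
  ext_exists := fuse_ext_exists R₁.hasExtMoves R₂.hasExtMoves
  trans t := by
    refine (fuse_trans_cases R₁.hasExtMoves R₂.hasExtMoves t).imp_right ?_
    rintro (⟨t₁, ht₁, h⟩ | ⟨t₂, ht₂, h⟩)
    · refine ⟨h.internal ht₁, fun ⟨s₁, s₂⟩ v he => ?_⟩
      obtain ⟨s', ho, ⟨b, hb⟩, hU⟩ := ((R₁.trans t₁).resolve_left
        (not_isExtMove_of_internal ht₁)).2 _ _ ((enabled_left h ht₁).1 he)
      refine ⟨(s', s₂), occurs_left h ht₁ ho,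
        ⟨b, (par_tr_iff R₁.total R₂.total _ _ _ _).2 (.inl ⟨hb, rfl⟩)⟩, fun hu => ?_⟩
      rw [h.label_eq]
      exact (par_tr_iff R₁.total R₂.total _ _ _ _).2 (.inl ⟨hU hu, rfl⟩)
    · refine ⟨h.internal ht₂, fun ⟨s₁, s₂⟩ v he => ?_⟩
      obtain ⟨s', ho, ⟨b, hb⟩, hU⟩ := ((R₂.trans t₂).resolve_left
        (not_isExtMove_of_internal ht₂)).2 _ _ ((enabled_right h ht₂).1 he)
      refine ⟨(s₁, s'), occurs_right h ht₂ ho,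
        ⟨b, (par_tr_iff R₁.total R₂.total _ _ _ _).2 (.inr ⟨hb, rfl⟩)⟩, fun hu => ?_⟩
      rw [h.label_eq]
      exact (par_tr_iff R₁.total R₂.total _ _ _ _).2 (.inr ⟨hU hu, rfl⟩)
  complete {s v a s'} hs := by
    obtain ⟨s₁, s₂⟩ := s
    obtain ⟨s₁', s₂'⟩ := s'
    rcases (par_tr_iff R₁.total R₂.total _ _ _ _).1 hs with ⟨h, e⟩ | ⟨h, e⟩
    · obtain rfl : s₂' = s₂ := e
      obtain ⟨t₁, ht₁, rfl, ho⟩ := R₁.complete h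
      obtain ⟨t, ht⟩ := exists_liftsLeft R₁.hasExtMoves R₂.hasExtMoves ht₁
      exact ⟨t, ht.internal ht₁, ht.label_eq, occurs_left ht ht₁ ho⟩
    · obtain rfl : s₁' = s₁ := e
      obtain ⟨t₂, ht₂, rfl, ho⟩ := R₂.complete h
      obtain ⟨t, ht⟩ := exists_liftsRight R₁.hasExtMoves R₂.hasExtMoves ht₂
      exact ⟨t, ht.internal ht₂, ht.label_eq, occurs_right ht ht₂ ho⟩

/-! ### Modules without external variables. -/

variable {N : INet Var D Lbl} {M : ReactiveModule Var D Lbl}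

/-- The marking of `N` that encodes a state of the closure of `M`. -/
noncomputable def closureMark (R : Represents U N M) (v₀ : M.I → D)
    (x : (M.closure v₀).toLTS.State) : N.Place → ℕ :=
  N.indicator (R.mark x.1 x.2)

theorem closure_tr_iff (hI : M.I = ∅) (v₀ : M.I → D) (x y : (M.closure v₀).toLTS.State)
    (a : Set Lbl) :
    (M.closure v₀).toLTS.Tr x a y ↔ M.Tr x.1 x.2 a y.1 := by
  have : IsEmpty M.I := Set.isEmpty_coe_sort.2 hI
  constructor
  · rintro ⟨-, h | ⟨-, -, i, -⟩⟩
    · exact h.1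
    · exact isEmptyElim i
  · intro h
    exact ⟨fun i => i.2.elim, .inl ⟨h, Subsingleton.elim _ _⟩⟩

theorem closureMark_injective (R : Represents U N M) (hI : M.I = ∅) (v₀ : M.I → D) :
    Function.Injective (R.closureMark v₀) := by
  have : IsEmpty M.I := Set.isEmpty_coe_sort.2 hI
  rintro ⟨s, v⟩ ⟨s', v'⟩ h
  obtain rfl : v = v' := Subsingleton.elim _ _
  rw [R.mark_inj s s' v (Net.indicator_eq_iff.1 h)]

theorem init_eq_closureMark (R : Represents U N M) (hI : M.I = ∅) (v₀ : M.I → D) :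
    N.toNet.markingLTS.init = R.closureMark v₀ (M.closure v₀).toLTS.init :=
  funext fun p => R.init_eq v₀ p fun c => (hI ▸ R.ext_mem c : N.extVar c ∈ (∅ : Set Var)).elim

theorem markingLTS_tr (R : Represents U N M) (hI : M.I = ∅) (v₀ : M.I → D)
    {x : (M.closure v₀).toLTS.State}
    {a : Set Lbl} {m : N.Place → ℕ} (h : N.toNet.markingLTS.Tr (R.closureMark v₀ x) a m) :
    ∃ y, m = R.closureMark v₀ y ∧ (∃ b, (M.closure v₀).toLTS.Tr x b y) ∧
      (U → (M.closure v₀).toLTS.Tr x a y) := by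
  obtain ⟨t, rfl, he, rfl⟩ := h
  rcases R.trans t with ⟨c, -⟩ | ⟨-, ht⟩
  -- An external component would belong to an external variable, and there is none.
  · exact (hI ▸ R.ext_mem c : N.extVar c ∈ (∅ : Set Var)).elim
  obtain ⟨s', ho, ⟨b, hb⟩, hU⟩ := ht x.1 x.2 (Net.enabled_indicator.1 he)
  exact ⟨(s', x.2), ho.fire_eq, ⟨b, (closure_tr_iff hI v₀ _ _ _).2 hb⟩,
    fun hu => (closure_tr_iff hI v₀ _ _ _).2 (hU hu)⟩

theorem markingLTS_tr_of_closure_tr (R : Represents U N M) (hI : M.I = ∅) (v₀ : M.I → D)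
    {x y : (M.closure v₀).toLTS.State} {a : Set Lbl} (h : (M.closure v₀).toLTS.Tr x a y) :
    N.toNet.markingLTS.Tr (R.closureMark v₀ x) a (R.closureMark v₀ y) := by
  have : IsEmpty M.I := Set.isEmpty_coe_sort.2 hI
  obtain ⟨t, -, ha, ho⟩ := R.complete ((closure_tr_iff hI v₀ _ _ _).1 h)
  refine ⟨t, ha, Net.enabled_indicator.2 ho.enabled, ?_⟩
  refine Eq.trans ?_ ho.fire_eq.symm
  rw [closureMark, Subsingleton.elim y.2 x.2]

theorem markingLTS_step_iff (R : Represents U N M) (hI : M.I = ∅) (v₀ : M.I → D)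
    (x : (M.closure v₀).toLTS.State)
    (m : N.Place → ℕ) : N.toNet.markingLTS.Step (R.closureMark v₀ x) m ↔
      ∃ y, m = R.closureMark v₀ y ∧ (M.closure v₀).toLTS.Step x y := by
  constructor
  · rintro ⟨a, h⟩
    obtain ⟨y, hy, h, -⟩ := R.markingLTS_tr hI v₀ h
    exact ⟨y, hy, h⟩
  · rintro ⟨y, rfl, a, h⟩
    exact ⟨a, R.markingLTS_tr_of_closure_tr hI v₀ h⟩

theorem oneSafe (R : Represents U N M) (hI : M.I = ∅) (v₀ : M.I → D) : N.toNet.OneSafe := by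
  intro m hm p
  obtain ⟨x, rfl, -⟩ := (LTS.reachable_iff_exists (R.init_eq_closureMark hI v₀)
    (R.markingLTS_step_iff hI v₀) m).1 hm
  unfold closureMark Net.indicator
  split_ifs <;> simp

theorem nonempty_graphIso (R : Represents U N M) (hI : M.I = ∅) (v₀ : M.I → D) :
    Nonempty (LTS.GraphIso N.toNet.markingGraph (M.closure v₀).toLTS.reachablePart) :=
  LTS.nonempty_graphIso (R.closureMark_injective hI v₀) (R.init_eq_closureMark hI v₀)
    (R.markingLTS_step_iff hI v₀)

theorem nonempty_iso (R : Represents U N M) (hU : U) (hI : M.I = ∅) (v₀ : M.I → D) :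
    Nonempty (LTS.Iso N.toNet.markingGraph (M.closure v₀).toLTS.reachablePart) := by
  refine LTS.nonempty_iso (R.closureMark_injective hI v₀) (R.init_eq_closureMark hI v₀)
    fun x a m => ⟨fun h => ?_, ?_⟩
  · obtain ⟨y, hy, -, h⟩ := R.markingLTS_tr hI v₀ h
    exact ⟨y, hy, h hU⟩
  · rintro ⟨y, rfl, h⟩
    exact R.markingLTS_tr_of_closure_tr hI v₀ h

end INet.Represents

/-! ### Iterated composition and the final result. -/

variable {Var D Lbl : Type u}

theorem globalModule_X (n : ℕ) (M : Fin (n + 1) → ReactiveModule Var D Lbl) :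
    (globalModule n M).X = ⋃ i, (M i).X := by
  induction n with
  | zero =>
    refine (Set.subset_iUnion (fun i => (M i).X) 0).antisymm (Set.iUnion_subset fun i => ?_)
    rw [Subsingleton.elim (α := Fin 1) i 0]
  | succ n ih =>
    refine (congrArg (· ∪ _) (ih fun i => M i.castSucc)).trans ?_
    refine (Set.union_subset (Set.iUnion_subset fun i => ?_) ?_).antisymm
      (Set.iUnion_subset fun i => ?_)
    · exact Set.subset_iUnion (fun i => (M i).X) i.castSucc
    · exact Set.subset_iUnion (fun i => (M i).X) (Fin.last (n + 1))
    · induction i using Fin.lastCases with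
      | last => exact Set.subset_union_right
      | cast i =>
        exact Set.subset_union_of_subset_left
          (Set.subset_iUnion (fun i : Fin (n + 1) => (M i.castSucc).X) i) _

theorem globalModule_I_subset (n : ℕ) (M : Fin (n + 1) → ReactiveModule Var D Lbl) :
    (globalModule n M).I ⊆ ⋃ i, (M i).I := by
  induction n with
  | zero => exact Set.subset_iUnion (fun i => (M i).I) 0
  | succ n ih =>
    rintro x ⟨hx | hx, -⟩
    · obtain ⟨i, hi⟩ := Set.mem_iUnion.1 (ih (fun i => M i.castSucc) hx)
      exact Set.mem_iUnion.2 ⟨_, hi⟩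
    · exact Set.mem_iUnion.2 ⟨_, hx⟩

/-- The external variables of the composition are disjoint from its internal ones, yet contained in
them. -/
theorem globalModule_I_eq_empty (n : ℕ) (M : Fin (n + 1) → ReactiveModule Var D Lbl)
    (hI : ∀ i, (M i).I ⊆ ⋃ j, (M j).X) : (globalModule n M).I = ∅ :=
  (globalModule n M).disj.symm.eq_bot_of_le <| by
    rw [globalModule_X]
    exact (globalModule_I_subset n M).trans (Set.iUnion_subset hI)

/-- The composed net represents the composed module. -/
noncomputable def globalRepresents {U : Prop} : (n : ℕ) →
    (M : Fin (n + 1) → ReactiveModule Var D Lbl) → (∀ i, (M i).IsAgent) →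
    (∀ i j, i ≠ j → Disjoint (M i).X (M j).X) → (S : ∀ i, Synthesis (M i).toLTS) →
    (init : ∀ i, (M i).I → D) → (U → ∀ i, (S i).UniformGuards) →
    (globalNet n M S init).Represents U (globalModule n M)
  | 0, _, hM, _, S, init, hU => (S 0).agentNetRepresents (hM 0) (init 0) fun hu => hU hu 0
  | n + 1, M, hM, hX, S, init, hU =>
    (globalRepresents n (fun i => M i.castSucc) (fun i => hM _)
      (fun i j hij => hX _ _ ((Fin.castSucc_injective _).ne hij)) (fun i => S i.castSucc)
      (fun i => init i.castSucc) fun hu _ => hU hu _).fuse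
    ((S (Fin.last (n + 1))).agentNetRepresents (hM _) (init _) fun hu => hU hu _) <| by
      rw [globalModule_X, Set.disjoint_iUnion_left]
      exact fun i => hX _ _ (Fin.castSucc_lt_last i).ne

end MAS

theorem proposition3 {Var D Lbl : Type u} (n : ℕ)
    (M : Fin (n + 1) → MAS.ReactiveModule Var D Lbl)
    (hM : ∀ i, (M i).IsAgent)
    (hX : ∀ i j, i ≠ j → Disjoint (M i).X (M j).X)
    (hI : ∀ i, (M i).I ⊆ ⋃ j, (M j).X)
    (S : ∀ i, MAS.Synthesis (M i).toLTS)
    (init : ∀ i, (M i).I → D)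
    (hinit : ∀ i j, MAS.Compat (init i) ((M j).val (M j).init))
    (vinit : (MAS.globalModule n M).I → D) :
    (MAS.globalNet n M S init).toNet.OneSafe ∧
    Nonempty (MAS.LTS.GraphIso (MAS.globalNet n M S init).toNet.markingGraph
      ((MAS.globalModule n M).closure vinit).toLTS.reachablePart) ∧
    ((∀ i, (S i).UniformGuards) →
      Nonempty (MAS.LTS.Iso (MAS.globalNet n M S init).toNet.markingGraph
        ((MAS.globalModule n M).closure vinit).toLTS.reachablePart)) := by
  -- With `U` taken to be the uniformity hypothesis itself, one representation serves both the
  -- unlabelled and the labelled statement.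
  have R := MAS.globalRepresents (U := ∀ i, (S i).UniformGuards) n M hM hX S init id
  have h := MAS.globalModule_I_eq_empty n M hI
  exact ⟨R.oneSafe h vinit, R.nonempty_graphIso h vinit, fun hU => R.nonempty_iso hU h vinit⟩
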